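/- Let $p>3$ be a prime and $\delta\ge 1$ an integer. For $N\ge 1$ let $D_N$ be the divided power algebra over $\mathbb{Z}/N$ of the free module $(\mathbb{Z}/N)^2$ with standard basis $\xi_1,\xi_2$; it is free over $\mathbb{Z}/N$ on the products $\xi_1^{(m)}\xi_2^{(n)}$ with $m,n\ge 0$, and $\xi_i^{(m)}\xi_i^{(n)}=\binom{m+n}{n}\xi_i^{(m+n)}$. A matrix $\begin{pmatrix}a&b\\c&d\end{pmatrix}\in \mathrm{SL}_2(\mathbb{Z}/N)$ acts on $D_N$ by $f(\xi_1,\xi_2)\mapsto f(a\xi_1+b\xi_2,\,c\xi_1+d\xi_2)$, and $D_N^{\mathrm{SL}_2(\mathbb{Z}/N)}$ denotes the set of elements fixed by all these substitutions. An element of $D_N^{\mathrm{SL}_2(\mathbb{Z}/N)}$ is called primitive if its additive order is exactly $N$. Then the element $$u_\delta=\sum_{j=1}^{p}\xi_1^{(p^{\delta-1}-1+jp^{\delta-1}(p-1))}\,\xi_2^{(p^{\delta-1}-1+(p-j+1)p^{\delta-1}(p-1))}\in D_p$$ is $\mathrm{SL}_2(\mathbb{F}_p)$-invariant, and it lifts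 to a primitive element $w_\delta$ of $D_{p^\delta}^{\mathrm{SL}_2(\mathbb{Z}/p^\delta)}$; that is, there is a primitive $w_\delta\in D_{p^\delta}^{\mathrm{SL}_2(\mathbb{Z}/p^\delta)}$ whose image under the reduction map $D_{p^\delta}\to D_p$ modulo $p$ is $u_\delta$. -/

import Mathlib

/-- The divided power algebra `D(V)` over `ℤ/N`, where `V = (ℤ/N)²`. -/
abbrev DivPow (N : ℕ) : Type := DividedPowerAlgebra (ZMod N) (Fin 2 → ZMod N)

namespace DivPow

noncomputable section

/-- The divided power `ξ_{i+1}^{(m)}`, where `ξ₁, ξ₂` (that is, `i = 0, 1`) is the standard basis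
of `V = (ℤ/N)²`. -/
def xi (N : ℕ) (i : Fin 2) (m : ℕ) : DivPow N :=
  DividedPowerAlgebra.dp (ZMod N) m (Pi.single i (1 : ZMod N) : Fin 2 → ZMod N)

/-- The substitution by a matrix `g = !![a, b; c, d]` of determinant one: the endomorphism
`f(ξ₁, ξ₂) ↦ f(a ξ₁ + b ξ₂, c ξ₁ + d ξ₂)` of the divided power algebra, induced by the linear
map `v ↦ v ᵥ* g` on `V`, which sends the `i`-th basis vector to the `i`-th row of `g`. -/
def act {N : ℕ} (g : Matrix.SpecialLinearGroup (Fin 2) (ZMod N)) :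
    DivPow N →ₐ[ZMod N] DivPow N :=
  DividedPowerAlgebra.map (ZMod N) (Matrix.vecMulLinear (g : Matrix (Fin 2) (Fin 2) (ZMod N)))

theorem act_xi {N : ℕ} (g : Matrix.SpecialLinearGroup (Fin 2) (ZMod N)) (i : Fin 2) (m : ℕ) :
    act g (xi N i m) = DividedPowerAlgebra.dp (ZMod N) m
      (g i 0 • (Pi.single 0 1 : Fin 2 → ZMod N) + g i 1 • (Pi.single 1 1 : Fin 2 → ZMod N)) := by
  rw [act, xi, DividedPowerAlgebra.map_apply_dp]
  congr 1
  ext k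
  fin_cases k <;> simp

/-- The subalgebra `D(V)^{SL₂(ℤ/N)}` of invariants. -/
def invariants (N : ℕ) : Subalgebra (ZMod N) (DivPow N) where
  carrier := {f | ∀ g : Matrix.SpecialLinearGroup (Fin 2) (ZMod N), act g f = f}
  mul_mem' hx hy g := by rw [map_mul, hx g, hy g]
  add_mem' hx hy g := by rw [map_add, hx g, hy g]
  algebraMap_mem' r g := AlgHom.commutes (act g) r

/-- An invariant over `ℤ/N` is primitive if its additive order is exactly `N`. -/
def IsPrimitive {N : ℕ} (w : invariants N) : Prop := addOrderOf w = N

/-- Reduction of coefficients `D((ℤ/N)²) → D((ℤ/M)²)` for `M ∣ N`: the ring homomorphism which is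
the canonical map on scalars and sends the `m`-th divided power of a vector `v` to the `m`-th
divided power of the reduction of `v` (see `reduction_algebraMap`, `reduction_dp`). -/
def reduction {M N : ℕ} (h : M ∣ N) : DivPow N →+* DivPow M :=
  letI : Algebra (ZMod N) (ZMod M) := (ZMod.castHom h (ZMod M)).toAlgebra
  (DividedPowerAlgebra.map (ZMod M)
    (LinearMap.compLeft (Algebra.linearMap (ZMod N) (ZMod M)) (Fin 2))).toRingHom

theorem reduction_dp {M N : ℕ} (h : M ∣ N) (m : ℕ) (v : Fin 2 → ZMod N) :
    reduction h (DividedPowerAlgebra.dp (ZMod N) m v) =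
      DividedPowerAlgebra.dp (ZMod M) m (fun i => ZMod.castHom h (ZMod M) (v i)) := by
  let _ : Algebra (ZMod N) (ZMod M) := (ZMod.castHom h (ZMod M)).toAlgebra
  exact DividedPowerAlgebra.map_apply_dp (ZMod M) _

theorem reduction_xi {M N : ℕ} (h : M ∣ N) (i : Fin 2) (m : ℕ) :
    reduction h (xi N i m) = xi M i m := by
  rw [xi, reduction_dp, xi]
  congr 1
  ext k
  by_cases hk : k = i
  · subst hk
    rw [Pi.single_eq_same, Pi.single_eq_same, map_one]
  · rw [Pi.single_eq_of_ne hk, Pi.single_eq_of_ne hk, map_zero]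

theorem reduction_algebraMap {M N : ℕ} (h : M ∣ N) (r : ZMod N) :
    reduction h (algebraMap (ZMod N) (DivPow N) r) =
      algebraMap (ZMod M) (DivPow M) (ZMod.castHom h (ZMod M) r) := by
  let _ : Algebra (ZMod N) (ZMod M) := (ZMod.castHom h (ZMod M)).toAlgebra
  exact AlgHom.commutes (DividedPowerAlgebra.map (ZMod M)
    (LinearMap.compLeft (Algebra.linearMap (ZMod N) (ZMod M)) (Fin 2))) r

/-- The element `u_δ` of the divided power algebra over `𝔽_p` (used for `1 ≤ δ`). -/
def u (p δ : ℕ) : DivPow p :=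
  ∑ j ∈ Finset.Icc 1 p,
    xi p 0 (p ^ (δ - 1) - 1 + j * p ^ (δ - 1) * (p - 1)) *
      xi p 1 (p ^ (δ - 1) - 1 + (p - j + 1) * p ^ (δ - 1) * (p - 1))

end

end DivPow

/-! Put `e = δ - 1`, `q = p ^ e`, and let `R` be `ℤ/p ^ (e + 1)` or `𝔽_p`. A linear functional `φ`
on binary forms of degree `n` gives an element of degree `n` in the divided power algebra: apply `φ`
to the coefficients of `(x ξ₁ + y ξ₂)^(n) = ∑ x ^ i y ^ j ξ₁^(i) ξ₂^(j)`. Substitution in the `ξ`'s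
becomes the transposed substitution in `x, y`, so invariant functionals give invariant elements
(`DivPow.act_ofFunctional`).

The Dickson invariants `L`, `Q` are `SL₂`-invariant modulo `p`. Congruent polynomials modulo `p`
have equal `q`-th powers over `R`, so `L ^ q` and `Q ^ q` are `SL₂(R)`-invariant. Their degrees are
`(p + 1) q` and `p (p - 1) q`. As for the socle of a complete intersection, the functionals killing
both and supported in degree `n`, the sum of the two degrees minus `2`, form a free `R`-module of
rank one. This comes from a square linear system that is invertible modulo `p`, hence over `R`
(`exists_socleFunctional`); invertibility modulo `p` is an explicit computation
(`dickson_relations`).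

Consequently `SL₂(R)` acts on the normalized functional by a character. It is trivial on the
diagonal torus, hence everywhere when `6` is invertible (`SL2.character_eq_one`). The same
computation modulo `p` identifies the reduced functional with `u_δ`. A coefficient equal to `1`,
with linear independence of the divided monomials, gives primitivity. -/

open MvPolynomial

/-! ### Exponent combinatorics of the Dickson relations in characteristic `p` -/

/-- A function on exponent pairs annihilated by the `q`-th powers of the two Dickson invariants
in characteristic `p` is supported in degree `q * (p ^ 2 + 1) - 2` on a single residue class. -/
theorem dickson_relations {K : Type*} [CommRing K] {p q d : ℕ} (hp : 2 ≤ p) (hq : 1 ≤ q)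
    (hd : q * p = q + d) (hpK : (p : K) = 0) (F : ℕ → ℕ → K)
    (hL : ∀ m m', F (m + q + d) (m' + q) = F (m + q) (m' + q + d))
    (hQ : ∀ m m', ∑ j ∈ Finset.range (p + 1), F (m + j * d) (m' + (p - j) * d) = 0) :
    (∀ j, j < p → F (q - 1 + (j + 1) * d) (q - 1 + (p - j) * d) =
      F (q - 1 + d) (q - 1 + p * d)) ∧
    ∀ M M', M + M' = 2 * (q - 1) + (p + 1) * d →
      (∀ j, j < p → M ≠ q - 1 + (j + 1) * d) → F M M' = 0 := by
  have hqd : q ≤ d := by nlinarith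
  -- Away from the boundary, the relation from `L ^ q` moves any multiple of `d` from one exponent
  -- to the other.
  have shift : ∀ j k m m', q ≤ m → q ≤ m' → F (m + j * d) (m' + k * d) = F m (m' + (j + k) * d) := by
    intro j
    induction j with
    | zero => intro k m m' _ _; simp
    | succ j ih =>
      intro k m m' hm hm'
      have h := hL (m + j * d - q) (m' + k * d - q)
      rw [show m + j * d - q + q = m + j * d by omega,
        show m' + k * d - q + q = m' + k * d by omega] at h
      rw [show m + (j + 1) * d = m + j * d + d by ring, h,
        show m' + k * d + d = m' + (k + 1) * d by ring, ih (k + 1) m m' hm hm',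
        show j + (k + 1) = j + 1 + k by ring]
  -- All `p + 1` terms of the `Q ^ q` relation coincide here, and `p + 1 = 1` in `K`.
  have interior : ∀ m m', q ≤ m → q ≤ m' → F m (m' + p * d) = 0 := by
    intro m m' hm hm'
    have h := hQ m m'
    rw [Finset.sum_congr rfl (g := fun _ => F m (m' + p * d))] at h
    · rw [Finset.sum_const, Finset.card_range, nsmul_eq_mul] at h
      push_cast at h
      rwa [hpK, zero_add, one_mul] at h
    · intro j hj
      rw [shift j (p - j) m m' hm hm', Nat.add_sub_cancel' (by simpa [Nat.lt_succ_iff] using hj)]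
  -- When only `m + d` is known to reach `q`, the term `j = 0` stands alone; the other `p` terms
  -- coincide and cancel since `p = 0`. The case `right` isolates `j = p` instead.
  have left : ∀ m m', q ≤ m + d → q ≤ m' → F m (m' + p * d) = 0 := by
    intro m m' hm hm'
    have h := hQ m m'
    rw [Finset.sum_range_succ', Finset.sum_congr rfl (g := fun _ => F (m + d) (m' + (p - 1) * d))]
      at h
    · rw [Finset.sum_const, Finset.card_range, nsmul_eq_mul, hpK] at h
      simpa using h
    · intro j hj
      rw [Finset.mem_range] at hj
      rw [show m + (j + 1) * d = m + d + j * d by ring, shift j _ (m + d) m' hm hm']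
      congr 3; omega
  have right : ∀ m m', q ≤ m → q ≤ m' + d → F (m + p * d) m' = 0 := by
    intro m m' hm hm'
    have h := hQ m m'
    rw [Finset.sum_range_succ, Finset.sum_congr rfl (g := fun _ => F m (m' + d + (p - 1) * d))] at h
    · rw [Finset.sum_const, Finset.card_range, nsmul_eq_mul, hpK] at h
      simpa using h
    · intro j hj
      rw [Finset.mem_range] at hj
      obtain ⟨k, rfl⟩ := Nat.exists_eq_add_of_lt hj
      rw [show j + k + 1 - j = k + 1 by omega, show m' + (k + 1) * d = m' + d + k * d by ring,
        shift j _ m (m' + d) hm hm']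
      congr 3
  refine ⟨fun j hj => ?_, fun M M' hM hne => ?_⟩
  · obtain ⟨k, rfl⟩ := Nat.exists_eq_add_of_lt hj
    have h := shift j k (q - 1 + d) (q - 1 + d) (by omega) (by omega)
    rw [show j + k + 1 - j = k + 1 by omega,
      show q - 1 + (j + 1) * d = q - 1 + d + j * d by ring,
      show q - 1 + (k + 1) * d = q - 1 + d + k * d by ring, h]
    congr 1; ring
  · have hd0 : 0 < d := by omega
    have hpd : p * d = (p - 1) * d + d := by
      obtain ⟨r, rfl⟩ := Nat.exists_eq_add_of_le hp
      rw [show 2 + r - 1 = 1 + r by omega]; ring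
    have hpd' : d ≤ (p - 1) * d := Nat.le_mul_of_pos_left d (by omega)
    have hsum : M + M' = 2 * (q - 1) + (p * d + d) := by rw [hM]; ring
    rcases lt_or_ge M q with h1 | h1
    · have := left M (M' - p * d) (by omega) (by omega)
      rwa [Nat.sub_add_cancel (by omega)] at this
    rcases lt_or_ge M' q with h2 | h2
    · have := right (M - p * d) M' (by omega) (by omega)
      rwa [Nat.sub_add_cancel (by omega)] at this
    have hdiv := Nat.div_add_mod (M - q) d
    set j := (M - q) / d
    set r := (M - q) % d
    have hr : r < d := Nat.mod_lt _ hd0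
    have hMe : M = r + q + j * d := by rw [mul_comm j d]; omega
    have hjp : j ≤ p := by
      by_contra hlt
      have : (p + 1) * d ≤ j * d := Nat.mul_le_mul_right d (by omega)
      have : (p + 1) * d = p * d + d := by ring
      omega
    obtain ⟨k, hk⟩ := Nat.exists_eq_add_of_le hjp
    have hkd : p * d = j * d + k * d := by rw [hk]; ring
    -- The residue `r = d - 1` is the exceptional class; there `j = p` would force `M' = q - 1`,
    -- contrary to `q ≤ M'`. For `r ≤ d - 2`, moving `j * d` across leaves at least `q` in both
    -- exponents, so `interior` applies.
    by_cases hrd : r + 1 = d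
    · exfalso
      have h3 : M = q - 1 + (j + 1) * d := by
        rw [show (j + 1) * d = j * d + d by ring]; omega
      refine hne j (lt_of_le_of_ne hjp fun hjp' => ?_) h3
      have hk0 : k = 0 := by omega
      subst hk0
      omega
    · have h3 : M' = (2 * (q - 1) + d - (r + q)) + k * d := by omega
      rw [hMe, h3, shift j k (r + q) _ (by omega) (by omega), ← hk]
      exact interior _ _ (by omega) (by omega)

/-! ### Dickson invariants and invariance of their `p ^ e`-th powers -/

/-- The Dickson invariant `x ^ p * y - x * y ^ p`. -/
noncomputable def dicksonL (R : Type*) [CommRing R] (p : ℕ) : MvPolynomial (Fin 2) R :=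
  X 0 ^ p * X 1 - X 0 * X 1 ^ p

/-- The Dickson invariant `(x ^ (p ^ 2 - 1) - y ^ (p ^ 2 - 1)) / (x ^ (p - 1) - y ^ (p - 1))`. -/
noncomputable def dicksonQ (R : Type*) [CommRing R] (p : ℕ) : MvPolynomial (Fin 2) R :=
  ∑ j ∈ Finset.range (p + 1), X 0 ^ (j * (p - 1)) * X 1 ^ ((p - j) * (p - 1))

/-- The linear substitution of variables given by the columns of a matrix. -/
noncomputable def linSubst {R : Type*} [CommRing R] (g : Matrix (Fin 2) (Fin 2) R) :
    MvPolynomial (Fin 2) R →ₐ[R] MvPolynomial (Fin 2) R :=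
  aeval fun j => C (g 0 j) * X 0 + C (g 1 j) * X 1

section
variable {R S : Type*} [CommRing R] [CommRing S]

theorem linSubst_X (g : Matrix (Fin 2) (Fin 2) R) (j : Fin 2) :
    linSubst g (X j) = C (g 0 j) * X 0 + C (g 1 j) * X 1 := aeval_X _ _

theorem map_linSubst (π : R →+* S) (g : Matrix (Fin 2) (Fin 2) R) (f : MvPolynomial (Fin 2) R) :
    map π (linSubst g f) = linSubst (g.map π) (map π f) := by
  have : (map π).comp (linSubst g : _ →ₐ[R] _).toRingHom =
      (linSubst (g.map π)).toRingHom.comp (map π) := by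
    apply MvPolynomial.ringHom_ext
    · intro r
      simp [linSubst]
    · intro j
      simp [linSubst]
  exact congrArg (fun h => h f) this

theorem linSubst_mul (g h : Matrix (Fin 2) (Fin 2) R) (f : MvPolynomial (Fin 2) R) :
    linSubst (g * h) f = linSubst g (linSubst h f) := by
  have : linSubst (g * h) = (linSubst g).comp (linSubst h) := by
    apply MvPolynomial.algHom_ext
    intro j
    simp only [linSubst_X, AlgHom.comp_apply, map_add, map_mul, Matrix.mul_apply, Fin.sum_univ_two,
      AlgHom.commutes, ← MvPolynomial.algebraMap_eq]
    ring
  rw [this, AlgHom.comp_apply]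

theorem linSubst_isHomogeneous (g : Matrix (Fin 2) (Fin 2) R) {f : MvPolynomial (Fin 2) R} {n : ℕ}
    (hf : f.IsHomogeneous n) : (linSubst g f).IsHomogeneous n := by
  have h := hf.aeval (fun j => C (g 0 j) * X 0 + C (g 1 j) * X 1 : Fin 2 → MvPolynomial (Fin 2) R)
    (n := 1) (fun j => by
      simpa using ((isHomogeneous_C (Fin 2) (g 0 j)).mul (isHomogeneous_X R 0)).add
        ((isHomogeneous_C (Fin 2) (g 1 j)).mul (isHomogeneous_X R 1)))
  rwa [one_mul] at h

theorem map_dicksonL (π : R →+* S) (p : ℕ) : map π (dicksonL R p) = dicksonL S p := by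
  simp [dicksonL]

theorem map_dicksonQ (π : R →+* S) (p : ℕ) : map π (dicksonQ R p) = dicksonQ S p := by
  simp [dicksonQ]

theorem dicksonL_isHomogeneous (p : ℕ) : (dicksonL R p).IsHomogeneous (p + 1) := by
  have h1 := (isHomogeneous_X_pow (R := R) (0 : Fin 2) p).mul (isHomogeneous_X R (1 : Fin 2))
  have h2 := (isHomogeneous_X R (0 : Fin 2)).mul (isHomogeneous_X_pow (R := R) (1 : Fin 2) p)
  rw [add_comm 1 p] at h2
  exact h1.sub h2

theorem dicksonQ_isHomogeneous (p : ℕ) : (dicksonQ R p).IsHomogeneous (p * (p - 1)) := by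
  refine IsHomogeneous.sum _ _ _ fun j hj => ?_
  rw [Finset.mem_range] at hj
  obtain ⟨k, rfl⟩ := Nat.exists_eq_add_of_le (Nat.lt_succ_iff.mp hj)
  have := (isHomogeneous_X_pow (R := R) (0 : Fin 2) (j * (j + k - 1))).mul
    (isHomogeneous_X_pow (R := R) (1 : Fin 2) ((j + k - j) * (j + k - 1)))
  convert this using 1
  rw [Nat.add_sub_cancel_left, ← add_mul]

theorem dicksonQ_mul_dicksonL {p : ℕ} (hp : 1 ≤ p) :
    dicksonQ R p * dicksonL R p = X 0 ^ (p ^ 2) * X 1 - X 0 * X 1 ^ (p ^ 2) := by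
  obtain ⟨e, rfl⟩ := Nat.exists_eq_add_of_le' hp
  have h := geom_sum₂_mul (X 0 ^ e : MvPolynomial (Fin 2) R) (X 1 ^ e) (e + 2)
  have hQ : dicksonQ R (e + 1) = ∑ i ∈ Finset.range (e + 2),
      (X 0 ^ e : MvPolynomial (Fin 2) R) ^ i * (X 1 ^ e) ^ (e + 2 - 1 - i) := by
    refine Finset.sum_congr rfl fun j _ => ?_
    rw [← pow_mul, ← pow_mul, Nat.add_sub_cancel, mul_comm j, mul_comm e (e + 2 - 1 - j)]
    rfl
  rw [← hQ, ← pow_mul, ← pow_mul] at h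
  have : dicksonL R (e + 1) = X 0 * X 1 * (X 0 ^ e - X 1 ^ e) := by rw [dicksonL]; ring
  rw [this, mul_left_comm, h]
  ring

/-- The polynomial is the determinant with rows `(x ^ p ^ k, y ^ p ^ k)` and `(x, y)`. Since the `p
^ k`-th power is additive and fixes `𝔽_p`, both rows transform by the same matrix, and the
determinant picks up the factor `det g = 1`. -/
theorem linSubst_frobenius {p : ℕ} [Fact p.Prime] {g : Matrix (Fin 2) (Fin 2) (ZMod p)}
    (hg : g.det = 1) (k : ℕ) :
    linSubst g (X 0 ^ p ^ k * X 1 - X 0 * X 1 ^ p ^ k) = X 0 ^ p ^ k * X 1 - X 0 * X 1 ^ p ^ k := by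
  have hdet : (C (g 0 0) * C (g 1 1) - C (g 0 1) * C (g 1 0) : MvPolynomial (Fin 2) (ZMod p)) = 1 := by
    rw [← map_mul, ← map_mul, ← map_sub, ← Matrix.det_fin_two, hg, map_one]
  have hC : ∀ a : ZMod p, (C a : MvPolynomial (Fin 2) (ZMod p)) ^ p ^ k = C a := fun a => by
    rw [← map_pow, ZMod.pow_card_pow]
  simp only [map_sub, map_mul, map_pow, linSubst_X, add_pow_char_pow, mul_pow, hC]
  linear_combination (X 0 ^ p ^ k * X 1 - X 0 * X 1 ^ p ^ k) * hdet

theorem linSubst_dicksonL {p : ℕ} [Fact p.Prime] {g : Matrix (Fin 2) (Fin 2) (ZMod p)}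
    (hg : g.det = 1) : linSubst g (dicksonL (ZMod p) p) = dicksonL (ZMod p) p := by
  simpa [dicksonL] using linSubst_frobenius hg 1

theorem dicksonL_ne_zero {p : ℕ} (hp : 2 ≤ p) [Nontrivial R] : dicksonL R p ≠ 0 := by
  intro h
  have h2 := congrArg (aeval (![Polynomial.X, 1] : Fin 2 → Polynomial R)) h
  simp only [dicksonL, map_sub, map_mul, map_pow, aeval_X, map_zero, Matrix.cons_val_zero,
    Matrix.cons_val_one, one_pow, mul_one] at h2
  have h3 := congrArg (fun f => Polynomial.coeff f p) h2
  simp [Polynomial.coeff_X, show (1 : ℕ) ≠ p by omega] at h3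

/-- `L` and `Q * L` are both Frobenius determinants, hence invariant, and `L` can be cancelled in a
domain. -/
theorem linSubst_dicksonQ {p : ℕ} [Fact p.Prime] {g : Matrix (Fin 2) (Fin 2) (ZMod p)}
    (hg : g.det = 1) : linSubst g (dicksonQ (ZMod p) p) = dicksonQ (ZMod p) p := by
  have hp := (Fact.out : p.Prime)
  apply mul_right_cancel₀ (dicksonL_ne_zero (R := ZMod p) hp.two_le)
  nth_rw 1 [← linSubst_dicksonL hg]
  rw [← map_mul, dicksonQ_mul_dicksonL hp.one_le, linSubst_frobenius hg 2]

/-- If `R` reduces to `𝔽_p` with kernel `(p)` and `p ^ (e + 1) = 0` in `R`, then `p ^ e`-th powers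
of polynomials only depend on the reductions. -/
theorem pow_eq_pow_of_map_eq {p e : ℕ} {π : R →+* S} (hπ : ∀ r, π r = 0 ↔ (p : R) ∣ r)
    (hpe : (p : R) ^ (e + 1) = 0) {f g : MvPolynomial (Fin 2) R} (h : map π f = map π g) :
    f ^ p ^ e = g ^ p ^ e := by
  have h1 : (C (p : R) : MvPolynomial (Fin 2) R) ∣ f - g := by
    rw [C_dvd_iff_map_hom_eq_zero π _ hπ, map_sub, h, sub_self]
  rw [map_natCast] at h1
  -- Each `p`-th power improves a congruence by one factor of `p`, so `p ∣ f - g` becomes `p ^ (e +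
  -- 1) ∣ f ^ p ^ e - g ^ p ^ e`.
  have h2 := dvd_sub_pow_of_dvd_sub h1 e
  rw [← map_natCast (C : R →+* MvPolynomial (Fin 2) R) p, ← map_pow, hpe, map_zero,
    zero_dvd_iff] at h2
  exact sub_eq_zero.mp h2

variable {p e : ℕ} [Fact p.Prime] {π : R →+* ZMod p}

theorem linSubst_dicksonL_pow (hπ : ∀ r, π r = 0 ↔ (p : R) ∣ r) (hpe : (p : R) ^ (e + 1) = 0)
    {g : Matrix (Fin 2) (Fin 2) R} (hg : g.det = 1) :
    linSubst g (dicksonL R p ^ p ^ e) = dicksonL R p ^ p ^ e := by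
  rw [map_pow]
  refine pow_eq_pow_of_map_eq hπ hpe ?_
  rw [map_linSubst, map_dicksonL, linSubst_dicksonL]
  have := RingHom.map_det π g
  rw [hg, map_one] at this
  exact this.symm

theorem linSubst_dicksonQ_pow (hπ : ∀ r, π r = 0 ↔ (p : R) ∣ r) (hpe : (p : R) ^ (e + 1) = 0)
    {g : Matrix (Fin 2) (Fin 2) R} (hg : g.det = 1) :
    linSubst g (dicksonQ R p ^ p ^ e) = dicksonQ R p ^ p ^ e := by
  rw [map_pow]
  refine pow_eq_pow_of_map_eq hπ hpe ?_
  rw [map_linSubst, map_dicksonQ, linSubst_dicksonQ]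
  have := RingHom.map_det π g
  rw [hg, map_one] at this
  exact this.symm

end

/-! ### Socle functionals as solutions of a square linear system -/

/-- A linear functional on binary forms, supported in degree `n`, which annihilates the ideal
generated by `A` and `B`. -/
structure IsSocleFunctional {R : Type*} [CommRing R] (A B : MvPolynomial (Fin 2) R) (n : ℕ)
    (φ : MvPolynomial (Fin 2) R →ₗ[R] R) : Prop where
  left (f) : φ (A * f) = 0
  right (f) : φ (B * f) = 0
  degree (i j : ℕ) : i + j ≠ n → φ (X 0 ^ i * X 1 ^ j) = 0

section
variable {R : Type*} [CommRing R]

theorem linearMap_ext_binary {M : Type*} [AddCommMonoid M] [Module R M]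
    {φ ψ : MvPolynomial (Fin 2) R →ₗ[R] M}
    (h : ∀ i j, φ (X 0 ^ i * X 1 ^ j) = ψ (X 0 ^ i * X 1 ^ j)) : φ = ψ := by
  refine (basisMonomials (Fin 2) R).ext fun s => ?_
  have : basisMonomials (Fin 2) R s = X 0 ^ s 0 * X 1 ^ s 1 := by
    rw [coe_basisMonomials]
    change monomial s (1 : R) = _
    rw [monomial_eq, Finsupp.prod_fintype _ _ (fun _ => pow_zero _),
      Fin.prod_univ_two, map_one, one_mul]
  rw [this, h]

theorem binary_monomial_isHomogeneous (i j : ℕ) :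
    (X 0 ^ i * X 1 ^ j : MvPolynomial (Fin 2) R).IsHomogeneous (i + j) :=
  (isHomogeneous_X_pow _ i).mul (isHomogeneous_X_pow _ j)

theorem coeff_binary_monomial (i j k l : ℕ) :
    coeff (Finsupp.single 0 k + Finsupp.single 1 l) (X 0 ^ i * X 1 ^ j : MvPolynomial (Fin 2) R) =
      if i = k ∧ j = l then 1 else 0 := by
  rw [X_pow_eq_monomial, X_pow_eq_monomial, monomial_mul, one_mul, coeff_monomial]
  congr 1
  rw [eq_iff_iff, Finsupp.ext_iff, Fin.forall_fin_two]
  simp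

theorem apply_eq_zero_of_isHomogeneous {n d : ℕ} {φ : MvPolynomial (Fin 2) R →ₗ[R] R}
    (hφ : ∀ i j : ℕ, i + j ≠ n → φ (X 0 ^ i * X 1 ^ j) = 0) {f : MvPolynomial (Fin 2) R}
    (hf : f.IsHomogeneous d) (hd : d ≠ n) : φ f = 0 := by
  rw [f.as_sum, map_sum]
  refine Finset.sum_eq_zero fun s hs => ?_
  rw [mem_support_iff] at hs
  have h1 : s 0 + s 1 = d := by
    by_contra hne
    refine hs (hf.coeff_eq_zero ?_)
    rw [Finsupp.degree_eq_sum, Fin.sum_univ_two]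
    exact hne
  rw [monomial_eq, Finsupp.prod_fintype _ _ (fun _ => pow_zero _), Fin.prod_univ_two, C_mul',
    map_smul, hφ _ _ (by omega), smul_zero]

/-- The functional on binary forms of degree `n` with given values on the monomials. -/
noncomputable def formFunctional {n : ℕ} (c : Fin (n + 1) → R) : MvPolynomial (Fin 2) R →ₗ[R] R :=
  ∑ m : Fin (n + 1), c m • lcoeff R (Finsupp.single 0 (m : ℕ) + Finsupp.single 1 (n - m))

theorem formFunctional_apply {n : ℕ} (c : Fin (n + 1) → R) (f : MvPolynomial (Fin 2) R) :
    formFunctional c f =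
      ∑ m : Fin (n + 1), c m * coeff (Finsupp.single 0 (m : ℕ) + Finsupp.single 1 (n - m)) f := by
  simp [formFunctional]

theorem formFunctional_monomial {n : ℕ} (c : Fin (n + 1) → R) (m : Fin (n + 1)) :
    formFunctional c (X 0 ^ (m : ℕ) * X 1 ^ (n - m)) = c m := by
  simp only [formFunctional_apply, coeff_binary_monomial]
  rw [Finset.sum_eq_single m]
  · simp
  · intro k _ hk
    rw [if_neg, mul_zero]
    exact fun h => hk (Fin.ext h.1.symm)
  · simp

theorem formFunctional_degree {n : ℕ} (c : Fin (n + 1) → R) (i j : ℕ) (h : i + j ≠ n) :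
    formFunctional c (X 0 ^ i * X 1 ^ j) = 0 := by
  simp only [formFunctional_apply, coeff_binary_monomial]
  refine Finset.sum_eq_zero fun m _ => ?_
  rw [if_neg, mul_zero]
  omega

theorem eq_formFunctional {n : ℕ} {φ : MvPolynomial (Fin 2) R →ₗ[R] R}
    (hφ : ∀ i j : ℕ, i + j ≠ n → φ (X 0 ^ i * X 1 ^ j) = 0) :
    φ = formFunctional fun m : Fin (n + 1) => φ (X 0 ^ (m : ℕ) * X 1 ^ (n - m)) := by
  refine linearMap_ext_binary fun i j => ?_
  by_cases h : i + j = n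
  · subst h
    have := formFunctional_monomial
      (fun m : Fin (i + j + 1) => φ (X 0 ^ (m : ℕ) * X 1 ^ (i + j - m))) ⟨i, by omega⟩
    simp only [Nat.add_sub_cancel_left] at this
    exact this.symm
  · rw [hφ i j h, formFunctional_degree _ i j h]

theorem map_formFunctional {S : Type*} [CommRing S] (π : R →+* S) {n : ℕ} (c : Fin (n + 1) → R)
    (f : MvPolynomial (Fin 2) R) :
    π (formFunctional c f) = formFunctional (fun m => π (c m)) (map π f) := by
  simp [formFunctional_apply, coeff_map]

/-- The square linear system whose solutions are the socle functionals for `A` and `B`, of degrees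
`α + 1` and `β + 1`, with a given value on the `m`-th monomial of degree `α + β`. -/
noncomputable def socleSystem (A B : MvPolynomial (Fin 2) R) {α β : ℕ} (m : Fin (α + β + 1))
    (c : Fin (α + β + 1) → R) : Fin β ⊕ Fin α ⊕ Unit → R :=
  Sum.elim (fun i => formFunctional c (A * (X 0 ^ (i : ℕ) * X 1 ^ (β - 1 - i))))
    (Sum.elim (fun i => formFunctional c (B * (X 0 ^ (i : ℕ) * X 1 ^ (α - 1 - i)))) fun _ => c m)

theorem socleSystem_add_mul (A B : MvPolynomial (Fin 2) R) {α β : ℕ} (m : Fin (α + β + 1))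
    (r : R) (c c' : Fin (α + β + 1) → R) (x : Fin β ⊕ Fin α ⊕ Unit) :
    socleSystem A B m (fun i => c i + r * c' i) x =
      socleSystem A B m c x + r * socleSystem A B m c' x := by
  rcases x with x | x | x <;>
    simp [socleSystem, formFunctional_apply, Finset.mul_sum, add_mul, Finset.sum_add_distrib,
      mul_assoc]

theorem map_socleSystem {S : Type*} [CommRing S] (π : R →+* S) (A B : MvPolynomial (Fin 2) R)
    {α β : ℕ} (m : Fin (α + β + 1)) (c : Fin (α + β + 1) → R) (x : Fin β ⊕ Fin α ⊕ Unit) :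
    π (socleSystem A B m c x) = socleSystem (map π A) (map π B) m (fun i => π (c i)) x := by
  rcases x with x | x | x <;> simp [socleSystem, map_formFunctional]

theorem isSocleFunctional_formFunctional {A B : MvPolynomial (Fin 2) R} {α β : ℕ}
    (hA : A.IsHomogeneous (α + 1)) (hB : B.IsHomogeneous (β + 1)) (m : Fin (α + β + 1))
    (c : Fin (α + β + 1) → R)
    (h1 : ∀ i, socleSystem A B m c (Sum.inl i) = 0)
    (h2 : ∀ i, socleSystem A B m c (Sum.inr (Sum.inl i)) = 0) :
    IsSocleFunctional A B (α + β) (formFunctional c) := by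
  have hdeg := formFunctional_degree c
  refine ⟨fun f => ?_, fun f => ?_, hdeg⟩
  · have : formFunctional c ∘ₗ LinearMap.mulLeft R A = 0 := by
      refine linearMap_ext_binary fun i j => ?_
      simp only [LinearMap.comp_apply, LinearMap.mulLeft_apply, LinearMap.zero_apply]
      -- Only multipliers of degree `β - 1` bring `A` into degree `α + β`, and these are the rows of
      -- the system; elsewhere `φ` vanishes by degree.
      by_cases h : i + j + 1 = β
      · have := h1 ⟨i, by omega⟩
        simp only [socleSystem, Sum.elim_inl] at this
        rwa [show β - 1 - i = j by omega] at this
      · exact apply_eq_zero_of_isHomogeneous hdeg (hA.mul (binary_monomial_isHomogeneous i j))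
          (by omega)
    exact LinearMap.congr_fun this f
  · have : formFunctional c ∘ₗ LinearMap.mulLeft R B = 0 := by
      refine linearMap_ext_binary fun i j => ?_
      simp only [LinearMap.comp_apply, LinearMap.mulLeft_apply, LinearMap.zero_apply]
      by_cases h : i + j + 1 = α
      · have := h2 ⟨i, by omega⟩
        simp only [socleSystem, Sum.elim_inl, Sum.elim_inr] at this
        rwa [show α - 1 - i = j by omega] at this
      · exact apply_eq_zero_of_isHomogeneous hdeg (hB.mul (binary_monomial_isHomogeneous i j))
          (by omega)
    exact LinearMap.congr_fun this f

/-- A square system over a finite ring which is injective modulo `p` is bijective, when `p` is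
nilpotent. -/
theorem socleSystem_bijective [Finite R] {S : Type*} [CommRing S] [Finite S] {π : R →+* S}
    (hsurj : Function.Surjective π) {p N : ℕ} (hπ : ∀ r, π r = 0 → (p : R) ∣ r)
    (hN : (p : R) ^ N = 0) {A B : MvPolynomial (Fin 2) R} {α β : ℕ} (m : Fin (α + β + 1))
    (hinj : Function.Injective (socleSystem (map π A) (map π B) m)) :
    Function.Bijective (socleSystem A B m) := by
  -- There are as many equations as unknowns, so over a finite ring injectivity and surjectivity are
  -- equivalent. Injectivity is known over `S`; surjectivity is what lifts to `R`.
  have e : Fin (α + β + 1) ≃ Fin β ⊕ Fin α ⊕ Unit :=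
    Fintype.equivOfCardEq (by simp; omega)
  have hbij : Function.Bijective (socleSystem (map π A) (map π B) m) :=
    (Nat.bijective_iff_injective_and_card _).mpr
      ⟨hinj, Nat.card_congr (Equiv.arrowCongr e (Equiv.refl S))⟩
  refine (Nat.bijective_iff_surjective_and_card _).mpr
    ⟨?_, Nat.card_congr (Equiv.arrowCongr e (Equiv.refl R))⟩
  have step : ∀ y : Fin β ⊕ Fin α ⊕ Unit → R, ∃ c, ∃ z : Fin β ⊕ Fin α ⊕ Unit → R,
      ∀ x, y x = socleSystem A B m c x + p * z x := by
    intro y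
    obtain ⟨c', hc'⟩ := hbij.2 fun x => π (y x)
    choose c hc using fun i => hsurj (c' i)
    have : ∀ x, ∃ z, y x - socleSystem A B m c x = p * z := fun x => hπ _ (by
      rw [map_sub, map_socleSystem]
      simp only [hc]
      rw [hc', sub_self])
    choose z hz using this
    exact ⟨c, z, fun x => by rw [← hz x]; ring⟩
  -- Successive approximation: solving again for the error gains a factor `p` each time, and `p ^ N
  -- = 0` ends the process.
  have iter : ∀ k : ℕ, ∀ y : Fin β ⊕ Fin α ⊕ Unit → R, ∃ c, ∃ z : Fin β ⊕ Fin α ⊕ Unit → R,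
      ∀ x, y x = socleSystem A B m c x + p ^ k * z x := by
    intro k
    induction k with
    | zero =>
      intro y
      obtain ⟨c, z, h⟩ := step y
      exact ⟨c, fun x => p * z x, by simpa using h⟩
    | succ k ih =>
      intro y
      obtain ⟨c, z, h⟩ := ih y
      obtain ⟨c', z', h'⟩ := step z
      refine ⟨fun i => c i + p ^ k * c' i, z', fun x => ?_⟩
      rw [socleSystem_add_mul, h, h']
      ring
  intro y
  obtain ⟨c, z, h⟩ := iter N y
  exact ⟨c, funext fun x => by rw [h, hN, zero_mul, add_zero]⟩

theorem IsSocleFunctional.sub {A B : MvPolynomial (Fin 2) R} {n : ℕ}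
    {φ ψ : MvPolynomial (Fin 2) R →ₗ[R] R}
    (hφ : IsSocleFunctional A B n φ) (hψ : IsSocleFunctional A B n ψ) :
    IsSocleFunctional A B n (φ - ψ) :=
  ⟨fun f => by simp [hφ.left, hψ.left], fun f => by simp [hφ.right, hψ.right],
    fun i j h => by simp [hφ.degree i j h, hψ.degree i j h]⟩

theorem IsSocleFunctional.smul {A B : MvPolynomial (Fin 2) R} {n : ℕ}
    {φ : MvPolynomial (Fin 2) R →ₗ[R] R} (hφ : IsSocleFunctional A B n φ) (r : R) :
    IsSocleFunctional A B n (r • φ) :=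
  ⟨fun f => by simp [hφ.left], fun f => by simp [hφ.right], fun i j h => by simp [hφ.degree i j h]⟩

theorem IsSocleFunctional.socleSystem_eq {A B : MvPolynomial (Fin 2) R} {α β : ℕ}
    {φ : MvPolynomial (Fin 2) R →ₗ[R] R} (hφ : IsSocleFunctional A B (α + β) φ)
    (m : Fin (α + β + 1)) :
    socleSystem A B m (fun i => φ (X 0 ^ (i : ℕ) * X 1 ^ (α + β - i))) =
      Sum.elim (fun _ => 0) (Sum.elim (fun _ => 0) fun _ => φ (X 0 ^ (m : ℕ) * X 1 ^ (α + β - m))) := by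
  rw [socleSystem, ← eq_formFunctional hφ.degree]
  simp only [hφ.left, hφ.right]

/-- Existence and uniqueness of the socle functional over `R`, from uniqueness modulo `p`. -/
theorem exists_socleFunctional [Finite R] {S : Type*} [CommRing S] [Finite S] {π : R →+* S}
    (hsurj : Function.Surjective π) {p N : ℕ} (hπ : ∀ r, π r = 0 → (p : R) ∣ r)
    (hN : (p : R) ^ N = 0) {A B : MvPolynomial (Fin 2) R} {α β : ℕ}
    (hA : A.IsHomogeneous (α + 1)) (hB : B.IsHomogeneous (β + 1)) {a b : ℕ} (hab : a + b = α + β)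
    (huniq : ∀ φ, IsSocleFunctional (map π A) (map π B) (α + β) φ →
      φ (X 0 ^ a * X 1 ^ b) = 0 → φ = 0) :
    ∃ φ, IsSocleFunctional A B (α + β) φ ∧ φ (X 0 ^ a * X 1 ^ b) = 1 ∧
      ∀ ψ, IsSocleFunctional A B (α + β) ψ → ψ = ψ (X 0 ^ a * X 1 ^ b) • φ := by
  let m : Fin (α + β + 1) := ⟨a, by omega⟩
  have hm : α + β - (m : ℕ) = b := by change α + β - a = b; omega
  have hinj : Function.Injective (socleSystem (map π A) (map π B) m) := by
    intro c c' hcc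
    have h0 : ∀ x, socleSystem (map π A) (map π B) m (fun i => c i + (-1) * c' i) x = 0 := fun x => by
      rw [socleSystem_add_mul, hcc]; ring
    have := huniq _ (isSocleFunctional_formFunctional (hA.map π) (hB.map π) m _
      (fun i => h0 _) (fun i => h0 _)) (by
        have h1 := formFunctional_monomial (fun i => c i + (-1) * c' i) m
        rw [hm] at h1
        exact h1.trans (h0 (Sum.inr (Sum.inr ()))))
    funext i
    have h1 := formFunctional_monomial (fun i => c i + (-1) * c' i) i
    rw [this, LinearMap.zero_apply] at h1
    linear_combination -h1
  have hbij := socleSystem_bijective hsurj hπ hN m hinj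
  obtain ⟨c, hc⟩ := hbij.2 (Sum.elim (fun _ => 0) (Sum.elim (fun _ => 0) fun _ => 1))
  have hφ := isSocleFunctional_formFunctional hA hB m c (fun i => congrFun hc _)
    (fun i => congrFun hc _)
  have hφ1 : formFunctional c (X 0 ^ a * X 1 ^ b) = 1 := by
    have h1 := formFunctional_monomial c m
    rw [hm] at h1
    exact h1.trans (congrFun hc (Sum.inr (Sum.inr ())))
  refine ⟨_, hφ, hφ1, fun ψ hψ => ?_⟩
  -- The value at the marked monomial is the last coordinate of the system, so injectivity forces a
  -- socle functional vanishing there to be zero.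
  have key : ∀ ψ, IsSocleFunctional A B (α + β) ψ → ψ (X 0 ^ a * X 1 ^ b) = 0 → ψ = 0 := by
    intro ψ hψ h0
    have h1 := hψ.socleSystem_eq m
    rw [hm] at h1
    change _ = Sum.elim (fun _ => 0) (Sum.elim (fun _ => 0) fun _ => ψ (X 0 ^ a * X 1 ^ b)) at h1
    rw [h0] at h1
    have h2 := (show IsSocleFunctional A B (α + β) 0 from
      ⟨fun _ => rfl, fun _ => rfl, fun _ _ _ => rfl⟩).socleSystem_eq m
    have h3 := hbij.1 (h1.trans h2.symm)
    rw [eq_formFunctional hψ.degree, h3]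
    ext f
    simp [formFunctional_apply]
  have := key _ (hψ.sub (hφ.smul (ψ (X 0 ^ a * X 1 ^ b)))) (by simp [hφ1])
  exact sub_eq_zero.mp this

end

/-! ### Generators and characters of `SL₂` over a local ring -/

namespace SL2
open Matrix

section
variable {R : Type*} [CommRing R]

/-- Upper unitriangular matrices. -/
def upper (t : R) : SpecialLinearGroup (Fin 2) R := ⟨!![1, t; 0, 1], by simp⟩

/-- Lower unitriangular matrices. -/
def lower (t : R) : SpecialLinearGroup (Fin 2) R := ⟨!![1, 0; t, 1], by simp⟩

/-- The diagonal torus. -/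
def diag (s : Rˣ) : SpecialLinearGroup (Fin 2) R :=
  ⟨!![(s : R), 0; 0, ((s⁻¹ : Rˣ) : R)], by simp⟩

theorem coe_upper (t : R) : (upper t : Matrix (Fin 2) (Fin 2) R) = !![1, t; 0, 1] := rfl

theorem coe_lower (t : R) : (lower t : Matrix (Fin 2) (Fin 2) R) = !![1, 0; t, 1] := rfl

theorem coe_diag (s : Rˣ) :
    (diag s : Matrix (Fin 2) (Fin 2) R) = !![(s : R), 0; 0, ((s⁻¹ : Rˣ) : R)] := rfl

theorem eq_lower_mul_diag_mul_upper (g : SpecialLinearGroup (Fin 2) R) (s : Rˣ)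
    (hs : (s : R) = g 0 0) :
    g = lower (g 1 0 * ((s⁻¹ : Rˣ) : R)) * diag s * upper (((s⁻¹ : Rˣ) : R) * g 0 1) := by
  have hdet := g.det_coe
  rw [Matrix.det_fin_two] at hdet
  have h1 : (s : R) * ((s⁻¹ : Rˣ) : R) = 1 := s.mul_inv
  ext i j
  fin_cases i <;> fin_cases j
  · simp [coe_lower, coe_diag, coe_upper, Matrix.mul_apply, Fin.sum_univ_two, hs]
  · simp [coe_lower, coe_diag, coe_upper, Matrix.mul_apply, Fin.sum_univ_two]
  · simp [coe_lower, coe_diag, coe_upper, Matrix.mul_apply, Fin.sum_univ_two, mul_assoc]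
  · simp [coe_lower, coe_diag, coe_upper, Matrix.mul_apply, Fin.sum_univ_two]
    rw [← hs] at hdet
    linear_combination ((s⁻¹ : Rˣ) : R) * hdet - g 1 1 * h1

/-- Over a local ring, `SL₂` is generated by elementary and diagonal matrices. -/
theorem induction_of_isLocalRing [IsLocalRing R] {P : SpecialLinearGroup (Fin 2) R → Prop}
    (hu : ∀ t, P (upper t)) (hl : ∀ t, P (lower t)) (hd : ∀ s, P (diag s))
    (hm : ∀ g h, P g → P h → P (g * h)) (g : SpecialLinearGroup (Fin 2) R) : P g := by
  have key : ∀ g : SpecialLinearGroup (Fin 2) R, IsUnit (g 0 0) → P g := by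
    rintro g ⟨s, hs⟩
    rw [eq_lower_mul_diag_mul_upper g s hs]
    exact hm _ _ (hm _ _ (hl _) (hd _)) (hu _)
  by_cases h : IsUnit (g 0 0)
  · exact key g h
  have hdet := g.det_coe
  rw [Matrix.det_fin_two] at hdet
  have hc : IsUnit (g 1 0) := by
    have h1 : IsUnit (g 0 0 * g 1 1 + -(g 0 1 * g 1 0)) := by
      rw [← sub_eq_add_neg, hdet]; exact isUnit_one
    rcases IsLocalRing.isUnit_or_isUnit_of_isUnit_add h1 with h2 | h2
    · exact absurd (isUnit_of_mul_isUnit_left h2) h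
    · rw [IsUnit.neg_iff] at h2
      exact isUnit_of_mul_isUnit_right h2
  -- The lower left entry is a unit, so adding the second row to the first makes the upper left
  -- entry a unit.
  have hg : g = upper (-1) * (upper 1 * g) := by
    rw [← mul_assoc, show upper (-1) * upper (1 : R) = 1 by
      ext i j; fin_cases i <;> fin_cases j <;>
        simp [coe_upper, Matrix.mul_apply, Fin.sum_univ_two], one_mul]
  rw [hg]
  refine hm _ _ (hu _) (key _ ?_)
  have h3 : (upper 1 * g : SpecialLinearGroup (Fin 2) R) 0 0 = g 0 0 + g 1 0 := by
    simp [coe_upper, Matrix.mul_apply, Fin.sum_univ_two]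
  rw [h3]
  have h4 : IsUnit ((g 0 0 + g 1 0) + -g 0 0) := by simpa using hc
  rcases IsLocalRing.isUnit_or_isUnit_of_isUnit_add h4 with h2 | h2
  · exact h2
  · exact absurd (IsUnit.neg_iff _ |>.mp h2) h

/-- A multiplicative character of `SL₂` which is trivial on the diagonal torus is trivial, over a
local ring in which `6` is invertible. -/
theorem character_eq_one [IsLocalRing R] (h2 : IsUnit (2 : R)) (h3 : IsUnit (3 : R))
    (χ : SpecialLinearGroup (Fin 2) R →* R) (hχ : ∀ s, χ (diag s) = 1)
    (g : SpecialLinearGroup (Fin 2) R) : χ g = 1 := by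
  obtain ⟨s, hs⟩ := h2
  obtain ⟨r, hr⟩ := h3
  have hr' : (3 : R) * ((r⁻¹ : Rˣ) : R) = 1 := by rw [← hr]; exact r.mul_inv
  have hunit : ∀ g, IsUnit (χ g) := fun g => (Group.isUnit g).map χ
  refine induction_of_isLocalRing (P := fun g => χ g = 1) (fun t => ?_) (fun t => ?_) hχ
    (fun g h hg hh => by rw [map_mul, hg, hh, one_mul]) g
  -- With `s = 2`, conjugation by `diag s` multiplies the parameter by `4`; from `t / 3` this gives
  -- `4t / 3 = t + t / 3`. Since `χ` takes unit values in a commutative ring, `χ (upper t) = 1`.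
  · have e : diag s * upper (((r⁻¹ : Rˣ) : R) * t) * diag s⁻¹ =
        upper t * upper (((r⁻¹ : Rˣ) : R) * t) := by
      ext i j
      fin_cases i <;> fin_cases j <;>
        simp [coe_upper, coe_diag, Matrix.mul_apply, Fin.sum_univ_two, hs]
      linear_combination t * hr'
    have := congrArg χ e
    rw [map_mul, map_mul, map_mul, hχ, hχ, one_mul, mul_one] at this
    exact ((hunit _).mul_right_cancel (by rw [one_mul]; exact this)).symm
  · have e : diag s⁻¹ * lower (((r⁻¹ : Rˣ) : R) * t) * diag s =
        lower t * lower (((r⁻¹ : Rˣ) : R) * t) := by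
      ext i j
      fin_cases i <;> fin_cases j <;>
        simp [coe_lower, coe_diag, Matrix.mul_apply, Fin.sum_univ_two, hs]
      linear_combination t * hr'
    have := congrArg χ e
    rw [map_mul, map_mul, map_mul, hχ, hχ, one_mul, mul_one] at this
    exact ((hunit _).mul_right_cancel (by rw [one_mul]; exact this)).symm

end
end SL2

/-! ### The invariant functional attached to `L ^ q` and `Q ^ q` -/

section
variable {R : Type*} [CommRing R]

/-- Socle functionals for the powers `L ^ q`, `Q ^ q` of the Dickson invariants. -/
abbrev IsDicksonFunctional (p q : ℕ) (φ : MvPolynomial (Fin 2) R →ₗ[R] R) : Prop :=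
  IsSocleFunctional (dicksonL R p ^ q) (dicksonQ R p ^ q)
    (2 * (q - 1) + (p + 1) * (q * (p - 1))) φ

/-- With `d = q (p - 1)`, Frobenius gives `L ^ q = x ^ (q + d) y ^ q - x ^ q y ^ (q + d)` and `Q ^ q
= ∑ x ^ (j d) y ^ ((p - j) d)`. Killing their multiples is the hypothesis of `dickson_relations`. -/
theorem dicksonFunctional_values {p : ℕ} [Fact p.Prime] {e : ℕ}
    {φ : MvPolynomial (Fin 2) (ZMod p) →ₗ[ZMod p] ZMod p} (hφ : IsDicksonFunctional p (p ^ e) φ) :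
    (∀ j, j < p → φ (X 0 ^ (p ^ e - 1 + (j + 1) * (p ^ e * (p - 1))) *
        X 1 ^ (p ^ e - 1 + (p - j) * (p ^ e * (p - 1)))) =
      φ (X 0 ^ (p ^ e - 1 + p ^ e * (p - 1)) * X 1 ^ (p ^ e - 1 + p * (p ^ e * (p - 1))))) ∧
    ∀ M M', M + M' = 2 * (p ^ e - 1) + (p + 1) * (p ^ e * (p - 1)) →
      (∀ j, j < p → M ≠ p ^ e - 1 + (j + 1) * (p ^ e * (p - 1))) → φ (X 0 ^ M * X 1 ^ M') = 0 := by
  have hp := (Fact.out : p.Prime)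
  have hd : p ^ e * p = p ^ e + p ^ e * (p - 1) := by
    obtain ⟨r, hr⟩ := Nat.exists_eq_add_of_le' hp.one_le
    rw [show p - 1 = r by omega, hr]; ring
  refine dickson_relations hp.two_le (Nat.one_le_pow _ _ hp.pos) hd (CharP.cast_eq_zero _ p)
    (fun i j => φ (X 0 ^ i * X 1 ^ j)) (fun m m' => ?_) (fun m m' => ?_)
  · have h := hφ.left (X 0 ^ m * X 1 ^ m')
    rw [dicksonL, sub_pow_char_pow, mul_pow, mul_pow, ← pow_mul, ← pow_mul, sub_mul, map_sub,
      sub_eq_zero, mul_comm p, hd] at h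
    convert h using 2 <;> ring
  · have h := hφ.right (X 0 ^ m * X 1 ^ m')
    rw [dicksonQ, sum_pow_char_pow, Finset.sum_mul, map_sum] at h
    rw [← h]
    refine Finset.sum_congr rfl fun j _ => congrArg φ ?_
    rw [mul_pow, ← pow_mul, ← pow_mul]
    ring

/-- Assumptions on a finite ring `R` with a surjection onto `𝔽_p`: the kernel is generated by `p`
and `p ^ (e + 1) = 0`. -/
structure IsTruncation (p e : ℕ) (π : R →+* ZMod p) : Prop where
  surjective : Function.Surjective π
  ker (r) : π r = 0 ↔ (p : R) ∣ r
  pow_eq_zero : (p : R) ^ (e + 1) = 0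

variable {p e : ℕ} [Fact p.Prime] {π : R →+* ZMod p}

theorem IsTruncation.isUnit (h : IsTruncation p e π) {r : R} (hr : π r ≠ 0) : IsUnit r := by
  obtain ⟨s, hs⟩ := h.surjective (π r)⁻¹
  have h1 : (p : R) ∣ r * s - 1 := by
    rw [← h.ker, map_sub, map_mul, hs, mul_inv_cancel₀ hr, map_one, sub_self]
  obtain ⟨z, hz⟩ := h1
  have hnil : IsNilpotent (p * z : R) := by
    refine ⟨e + 1, ?_⟩
    rw [mul_pow, h.pow_eq_zero, zero_mul]
  have h2 : IsUnit (1 + p * z : R) := hnil.isUnit_one_add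
  rw [← hz, add_sub_cancel] at h2
  exact isUnit_of_mul_isUnit_left h2

theorem IsTruncation.isLocalRing (h : IsTruncation p e π) : IsLocalRing R := by
  have : Nontrivial R := π.domain_nontrivial
  refine IsLocalRing.of_isUnit_or_isUnit_one_sub_self fun r => ?_
  by_cases hr : π r = 0
  · right
    exact h.isUnit (by rw [map_sub, hr, map_one, sub_zero]; exact one_ne_zero)
  · exact Or.inl (h.isUnit hr)

theorem IsTruncation.pow_eq_one (h : IsTruncation p e π) (s : Rˣ) :
    (s : R) ^ (p ^ e * (p - 1)) = 1 := by
  have h1 : (p : R) ∣ (s : R) ^ (p - 1) - 1 := by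
    rw [← h.ker, map_sub, map_pow, map_one, ZMod.pow_card_sub_one_eq_one (s.isUnit.map π).ne_zero,
      sub_self]
  have h2 := dvd_sub_pow_of_dvd_sub h1 e
  rw [h.pow_eq_zero, zero_dvd_iff, one_pow, ← pow_mul, mul_comm] at h2
  exact sub_eq_zero.mp h2

/-- Modulo `p` a functional of this kind is determined by its value at one exceptional monomial, by
`dicksonFunctional_values`; this is the uniqueness needed by `exists_socleFunctional`. -/
theorem IsTruncation.exists_dicksonFunctional [Finite R] (h : IsTruncation p e π) :
    ∃ φ : MvPolynomial (Fin 2) R →ₗ[R] R, IsDicksonFunctional p (p ^ e) φ ∧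
      φ (X 0 ^ (p ^ e - 1 + p ^ e * (p - 1)) * X 1 ^ (p ^ e - 1 + p * (p ^ e * (p - 1)))) = 1 ∧
      ∀ ψ, IsDicksonFunctional p (p ^ e) ψ → ψ = ψ (X 0 ^ (p ^ e - 1 + p ^ e * (p - 1)) *
        X 1 ^ (p ^ e - 1 + p * (p ^ e * (p - 1)))) • φ := by
  have hp := (Fact.out : p.Prime)
  have hA := (dicksonL_isHomogeneous (R := R) p).pow (p ^ e)
  have hB := (dicksonQ_isHomogeneous (R := R) p).pow (p ^ e)
  have hq : 1 ≤ p ^ e := Nat.one_le_pow _ _ hp.pos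
  have hpp : 1 ≤ p * (p - 1) := Nat.mul_pos hp.pos (by have := hp.two_le; omega)
  have hn : (p + 1) * p ^ e - 1 + (p * (p - 1) * p ^ e - 1) =
      2 * (p ^ e - 1) + (p + 1) * (p ^ e * (p - 1)) := by
    have e1 : 1 ≤ (p + 1) * p ^ e := Nat.mul_pos (by omega) hq
    have e2 : 1 ≤ p * (p - 1) * p ^ e := Nat.mul_pos hpp hq
    have e3 : (p + 1) * p ^ e + p * (p - 1) * p ^ e =
        2 * p ^ e + (p + 1) * (p ^ e * (p - 1)) := by
      obtain ⟨r, hr⟩ := Nat.exists_eq_add_of_le' hp.one_le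
      rw [show p - 1 = r by omega, hr]; ring
    omega
  have := exists_socleFunctional h.surjective (fun r => (h.ker r).mp) h.pow_eq_zero
    (α := (p + 1) * p ^ e - 1) (β := p * (p - 1) * p ^ e - 1)
    (by rwa [Nat.sub_add_cancel (Nat.mul_pos (by omega) hq)])
    (by rwa [Nat.sub_add_cancel (Nat.mul_pos hpp hq)])
    (a := p ^ e - 1 + p ^ e * (p - 1)) (b := p ^ e - 1 + p * (p ^ e * (p - 1)))
    (by rw [hn]; ring) (by
      rw [hn]
      intro φ hφ h0
      rw [map_pow, map_pow, map_dicksonL, map_dicksonQ] at hφ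
      obtain ⟨h1, h2⟩ := dicksonFunctional_values hφ
      refine linearMap_ext_binary fun M M' => ?_
      rw [LinearMap.zero_apply]
      by_cases hM : M + M' = 2 * (p ^ e - 1) + (p + 1) * (p ^ e * (p - 1))
      · by_cases hj : ∃ j, j < p ∧ M = p ^ e - 1 + (j + 1) * (p ^ e * (p - 1))
        · obtain ⟨j, hj, rfl⟩ := hj
          obtain ⟨k, rfl⟩ := Nat.exists_eq_add_of_lt hj
          have : M' = (j + k + 1) ^ e - 1 + (j + k + 1 - j) *
              ((j + k + 1) ^ e * (j + k + 1 - 1)) := by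
            rw [show j + k + 1 - j = k + 1 by omega]
            have e4 : (j + k + 1 + 1) * ((j + k + 1) ^ e * (j + k + 1 - 1)) =
              (j + 1) * ((j + k + 1) ^ e * (j + k + 1 - 1)) +
                (k + 1) * ((j + k + 1) ^ e * (j + k + 1 - 1)) := by ring
            omega
          rw [this, h1 j hj, h0]
        · exact h2 M M' hM fun j hjp hje => hj ⟨j, hjp, hje⟩
      · exact hφ.degree M M' hM)
  rwa [hn] at this

theorem IsDicksonFunctional.comp_linSubst (h : IsTruncation p e π)
    {φ : MvPolynomial (Fin 2) R →ₗ[R] R} (hφ : IsDicksonFunctional p (p ^ e) φ)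
    (g : Matrix.SpecialLinearGroup (Fin 2) R) :
    IsDicksonFunctional p (p ^ e) (φ ∘ₗ (linSubst (g : Matrix (Fin 2) (Fin 2) R)).toLinearMap) where
  left f := by
    simp [linSubst_dicksonL_pow h.ker h.pow_eq_zero g.det_coe, hφ.left, -map_pow]
  right f := by
    simp [linSubst_dicksonQ_pow h.ker h.pow_eq_zero g.det_coe, hφ.right, -map_pow]
  degree i j hij := apply_eq_zero_of_isHomogeneous hφ.degree
    (linSubst_isHomogeneous _ (binary_monomial_isHomogeneous i j)) hij

/-- For `p > 3` the normalized functional killing `L ^ q` and `Q ^ q` is `SL₂`-invariant. -/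
theorem IsTruncation.exists_invariant_dicksonFunctional [Finite R] (h : IsTruncation p e π)
    (hp3 : 3 < p) :
    ∃ φ : MvPolynomial (Fin 2) R →ₗ[R] R, IsDicksonFunctional p (p ^ e) φ ∧
      φ (X 0 ^ (p ^ e - 1 + p ^ e * (p - 1)) * X 1 ^ (p ^ e - 1 + p * (p ^ e * (p - 1)))) = 1 ∧
      ∀ g : Matrix.SpecialLinearGroup (Fin 2) R,
        φ ∘ₗ (linSubst (g : Matrix (Fin 2) (Fin 2) R)).toLinearMap = φ := by
  obtain ⟨φ, hφ, h1, huniq⟩ := h.exists_dicksonFunctional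
  refine ⟨φ, hφ, h1, ?_⟩
  have hloc := h.isLocalRing
  set P : MvPolynomial (Fin 2) R :=
    X 0 ^ (p ^ e - 1 + p ^ e * (p - 1)) * X 1 ^ (p ^ e - 1 + p * (p ^ e * (p - 1))) with hP
  -- Composition with `g` gives another Dickson functional, so uniqueness makes it a scalar multiple
  -- of `φ`; the scalar is the character value `χ g`.
  have hχ : ∀ (g : Matrix.SpecialLinearGroup (Fin 2) R) f,
      φ (linSubst (g : Matrix (Fin 2) (Fin 2) R) f) =
        φ (linSubst (g : Matrix (Fin 2) (Fin 2) R) P) * φ f := fun g f =>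
    LinearMap.congr_fun (huniq _ (hφ.comp_linSubst h g)) f
  have hone : ∀ f, linSubst (1 : Matrix (Fin 2) (Fin 2) R) f = f := fun f => by
    have : linSubst (1 : Matrix (Fin 2) (Fin 2) R) = AlgHom.id R _ := by
      apply MvPolynomial.algHom_ext
      intro j
      fin_cases j <;> simp [linSubst_X]
    rw [this, AlgHom.id_apply]
  let χ : Matrix.SpecialLinearGroup (Fin 2) R →* R :=
    { toFun g := φ (linSubst (g : Matrix (Fin 2) (Fin 2) R) P)
      map_one' := by rw [Matrix.SpecialLinearGroup.coe_one, hone, h1]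
      map_mul' g g' := by rw [Matrix.SpecialLinearGroup.coe_mul, linSubst_mul, hχ] }
  -- This is where `p > 3` enters: it makes `2` and `3` units.
  have hcast : ∀ k : ℕ, 0 < k → k < p → IsUnit (k : R) := fun k hk hkp => h.isUnit (by
    rw [map_natCast, Ne, ZMod.natCast_eq_zero_iff]
    exact fun hdvd => absurd (Nat.le_of_dvd hk hdvd) (by omega))
  have htriv := SL2.character_eq_one (R := R) (by exact_mod_cast hcast 2 (by omega) (by omega))
    (by exact_mod_cast hcast 3 (by omega) (by omega)) χ (fun s => by
      change φ (linSubst !![(s : R), 0; 0, ((s⁻¹ : Rˣ) : R)] P) = 1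
      have h2 : linSubst !![(s : R), 0; 0, ((s⁻¹ : Rˣ) : R)] P = P := by
        -- The two exponents of `P` are both `p ^ e - 1` modulo `p ^ e * (p - 1)`, a multiple of the
        -- order of every unit, so the torus fixes `P`.
        have h3 : ((s : R) ^ (p ^ e - 1 + p ^ e * (p - 1))) *
            ((s⁻¹ : Rˣ) : R) ^ (p ^ e - 1 + p * (p ^ e * (p - 1))) = 1 := by
          rw [pow_add, pow_add, mul_comm p, pow_mul ((s⁻¹ : Rˣ) : R), h.pow_eq_one, h.pow_eq_one,
            one_pow, mul_one, mul_one, ← mul_pow, Units.mul_inv, one_pow]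
        simp only [hP, map_mul, map_pow, linSubst_X, Matrix.of_apply, Matrix.cons_val_zero,
          Matrix.cons_val_one, Matrix.cons_val', Matrix.cons_val_fin_one, map_zero, zero_mul,
          add_zero, zero_add, mul_pow]
        rw [← C_pow, ← C_pow, mul_mul_mul_comm, ← C_mul, h3, C_1, one_mul]
      rw [h2, h1])
  intro g
  refine LinearMap.ext fun f => ?_
  have h2 : φ (linSubst (g : Matrix (Fin 2) (Fin 2) R) P) = 1 := htriv g
  have h3 := hχ g f
  rw [h2, one_mul] at h3
  exact h3

end

/-! ### Duality between binary forms and divided powers -/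

theorem sum_antidiagonal_assoc {M : Type*} [AddCommMonoid M] (n : ℕ) (f : ℕ → ℕ → ℕ → M) :
    ∑ x ∈ Finset.HasAntidiagonal.antidiagonal n, ∑ y ∈ Finset.HasAntidiagonal.antidiagonal x.1, f y.1 y.2 x.2 =
      ∑ x ∈ Finset.HasAntidiagonal.antidiagonal n, ∑ y ∈ Finset.HasAntidiagonal.antidiagonal x.2, f x.1 y.1 y.2 := by
  rw [Finset.sum_sigma', Finset.sum_sigma']
  refine Finset.sum_nbij' (fun z => ⟨(z.2.1, z.2.2 + z.1.2), (z.2.2, z.1.2)⟩)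
    (fun z => ⟨(z.1.1 + z.2.1, z.2.2), (z.1.1, z.2.1)⟩) ?_ ?_ ?_ ?_ ?_
  · rintro ⟨⟨a, b⟩, ⟨c, d⟩⟩
    simp only [Finset.mem_sigma, Finset.HasAntidiagonal.mem_antidiagonal]
    rintro ⟨h1, h2⟩
    exact ⟨by omega, trivial⟩
  · rintro ⟨⟨a, b⟩, ⟨c, d⟩⟩
    simp only [Finset.mem_sigma, Finset.HasAntidiagonal.mem_antidiagonal]
    rintro ⟨h1, h2⟩
    exact ⟨by omega, trivial⟩
  · rintro ⟨⟨a, b⟩, ⟨c, d⟩⟩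
    simp only [Finset.mem_sigma, Finset.HasAntidiagonal.mem_antidiagonal]
    rintro ⟨-, rfl⟩
    rfl
  · rintro ⟨⟨a, b⟩, ⟨c, d⟩⟩
    simp only [Finset.mem_sigma, Finset.HasAntidiagonal.mem_antidiagonal]
    rintro ⟨-, rfl⟩
    rfl
  · intro z _
    rfl

namespace DivPow

variable {N : ℕ}

theorem xi_mul (i : Fin 2) (m n : ℕ) :
    xi N i m * xi N i n = (m + n).choose m • xi N i (m + n) :=
  DividedPowerAlgebra.dp_mul

theorem dp_add_smul (a b : ZMod N) (m : ℕ) :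
    DividedPowerAlgebra.dp (ZMod N) m
      (a • (Pi.single 0 1 : Fin 2 → ZMod N) + b • (Pi.single 1 1 : Fin 2 → ZMod N)) =
    ∑ x ∈ Finset.HasAntidiagonal.antidiagonal m, (a ^ x.1 * b ^ x.2) • (xi N 0 x.1 * xi N 1 x.2) := by
  rw [DividedPowerAlgebra.dp_add]
  refine Finset.sum_congr rfl fun x _ => ?_
  rw [DividedPowerAlgebra.dp_smul, DividedPowerAlgebra.dp_smul, smul_mul_smul_comm]
  rfl

theorem act_mul (g h : Matrix.SpecialLinearGroup (Fin 2) (ZMod N)) (f : DivPow N) :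
    act (g * h) f = act h (act g f) := by
  have : act (g * h) = (act h).comp (act g) := by
    refine DividedPowerAlgebra.algHom_ext fun n m => ?_
    simp only [act, AlgHom.comp_apply, DividedPowerAlgebra.map_apply_dp,
      Matrix.vecMulLinear_apply, Matrix.SpecialLinearGroup.coe_mul, Matrix.vecMul_vecMul]
  rw [this, AlgHom.comp_apply]

/-- The element of degree `n` with coefficients given by a functional on binary forms. -/
noncomputable def ofFunctional (n : ℕ) (φ : MvPolynomial (Fin 2) (ZMod N) →ₗ[ZMod N] ZMod N) :
    DivPow N :=
  ∑ x ∈ Finset.HasAntidiagonal.antidiagonal n, φ (X 0 ^ x.1 * X 1 ^ x.2) • (xi N 0 x.1 * xi N 1 x.2)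

/-- Both sides become one sum over `k + l + j = n`: the binomial coefficient from `(t x + y) ^ (l +
j)` is the one in `ξ₂^(l) ξ₂^(j)`. -/
theorem act_upper_ofFunctional (n : ℕ) (φ : MvPolynomial (Fin 2) (ZMod N) →ₗ[ZMod N] ZMod N)
    (t : ZMod N) : act (SL2.upper t) (ofFunctional n φ) =
      ofFunctional n (φ ∘ₗ (linSubst (SL2.upper t).1).toLinearMap) := by
  have e0 : ∀ m, act (SL2.upper t) (xi N 0 m) =
      ∑ x ∈ Finset.HasAntidiagonal.antidiagonal m, t ^ x.2 • (xi N 0 x.1 * xi N 1 x.2) := fun m => by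
    rw [act_xi, dp_add_smul]
    simp [SL2.coe_upper]
  have e1 : ∀ m, act (SL2.upper t) (xi N 1 m) = xi N 1 m := fun m => by
    rw [act_xi]
    simp [SL2.coe_upper, xi]
  have f0 : ∀ m, linSubst (SL2.upper t).1 (X 0 ^ m) = X 0 ^ m := fun m => by
    rw [map_pow, linSubst_X]
    simp [SL2.coe_upper]
  have f1 : ∀ m, linSubst (SL2.upper t).1 (X 1 ^ m) =
      ∑ x ∈ Finset.HasAntidiagonal.antidiagonal m, (m.choose x.1 * t ^ x.1) • (X 0 ^ x.1 * X 1 ^ x.2) := fun m => by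
    rw [map_pow, linSubst_X, (Commute.all _ _).add_pow']
    refine Finset.sum_congr rfl fun x _ => ?_
    simp [SL2.coe_upper, mul_pow, smul_eq_C_mul, mul_assoc]
  simp only [ofFunctional, map_sum, map_smul, map_mul, e0, e1, LinearMap.comp_apply,
    AlgHom.toLinearMap_apply, f0, f1, Finset.sum_mul, Finset.mul_sum, Finset.smul_sum,
    Finset.sum_smul]
  have key := sum_antidiagonal_assoc n fun k l j =>
    φ (X 0 ^ (k + l) * X 1 ^ j) • ((t ^ l • (xi N 0 k * xi N 1 l)) * xi N 1 j)
  refine Eq.trans ?_ (key.trans ?_)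
  · refine Finset.sum_congr rfl fun x _ => Finset.sum_congr rfl fun y hy => ?_
    rw [Finset.HasAntidiagonal.mem_antidiagonal.mp hy]
  · refine Finset.sum_congr rfl fun x _ => Finset.sum_congr rfl fun y hy => ?_
    rw [← Finset.HasAntidiagonal.mem_antidiagonal.mp hy, smul_mul_assoc, mul_assoc, xi_mul, mul_smul_comm _ (X 0 ^ _ : MvPolynomial (Fin 2) (ZMod N)),
      map_smul, ← mul_assoc (X 0 ^ _), ← pow_add, mul_smul_comm, ← Nat.cast_smul_eq_nsmul (ZMod N),
      smul_smul, smul_smul, smul_eq_mul]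
    congr 1
    ring

theorem act_lower_ofFunctional (n : ℕ) (φ : MvPolynomial (Fin 2) (ZMod N) →ₗ[ZMod N] ZMod N)
    (t : ZMod N) : act (SL2.lower t) (ofFunctional n φ) =
      ofFunctional n (φ ∘ₗ (linSubst (SL2.lower t).1).toLinearMap) := by
  have e0 : ∀ m, act (SL2.lower t) (xi N 0 m) = xi N 0 m := fun m => by
    rw [act_xi]
    simp [SL2.coe_lower, xi]
  have e1 : ∀ m, act (SL2.lower t) (xi N 1 m) =
      ∑ x ∈ Finset.HasAntidiagonal.antidiagonal m, t ^ x.1 • (xi N 0 x.1 * xi N 1 x.2) := fun m => by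
    rw [act_xi, dp_add_smul]
    simp [SL2.coe_lower]
  have f0 : ∀ m, linSubst (SL2.lower t).1 (X 0 ^ m) =
      ∑ x ∈ Finset.HasAntidiagonal.antidiagonal m, (m.choose x.1 * t ^ x.2) • (X 0 ^ x.1 * X 1 ^ x.2) := fun m => by
    rw [map_pow, linSubst_X, (Commute.all _ _).add_pow']
    refine Finset.sum_congr rfl fun x _ => ?_
    simp [SL2.coe_lower, mul_pow, smul_eq_C_mul, mul_assoc, mul_left_comm]
  have f1 : ∀ m, linSubst (SL2.lower t).1 (X 1 ^ m) = X 1 ^ m := fun m => by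
    rw [map_pow, linSubst_X]
    simp [SL2.coe_lower]
  simp only [ofFunctional, map_sum, map_smul, map_mul, e0, e1, LinearMap.comp_apply,
    AlgHom.toLinearMap_apply, f0, f1, Finset.sum_mul, Finset.mul_sum, Finset.smul_sum,
    Finset.sum_smul]
  have key := sum_antidiagonal_assoc n fun i k l =>
    φ (X 0 ^ i * X 1 ^ (k + l)) • (xi N 0 i * (t ^ k • (xi N 0 k * xi N 1 l)))
  refine Eq.trans ?_ (key.symm.trans ?_)
  · refine Finset.sum_congr rfl fun x _ => Finset.sum_congr rfl fun y hy => ?_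
    rw [Finset.HasAntidiagonal.mem_antidiagonal.mp hy]
  · refine Finset.sum_congr rfl fun x _ => Finset.sum_congr rfl fun y hy => ?_
    rw [← Finset.HasAntidiagonal.mem_antidiagonal.mp hy, mul_smul_comm, ← mul_assoc, xi_mul, smul_mul_assoc,
      smul_mul_assoc, map_smul, mul_assoc (X 0 ^ _), ← pow_add,
      ← Nat.cast_smul_eq_nsmul (ZMod N), smul_smul, smul_smul, smul_eq_mul]
    congr 1
    ring

theorem act_diag_ofFunctional (n : ℕ) (φ : MvPolynomial (Fin 2) (ZMod N) →ₗ[ZMod N] ZMod N)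
    (s : (ZMod N)ˣ) : act (SL2.diag s) (ofFunctional n φ) =
      ofFunctional n (φ ∘ₗ (linSubst (SL2.diag s).1).toLinearMap) := by
  have e0 : ∀ m, act (SL2.diag s) (xi N 0 m) = (s : ZMod N) ^ m • xi N 0 m := fun m => by
    rw [act_xi]
    simp [SL2.coe_diag, xi, -ZMod.inv_coe_unit, DividedPowerAlgebra.dp_smul]
  have e1 : ∀ m, act (SL2.diag s) (xi N 1 m) = ((s⁻¹ : (ZMod N)ˣ) : ZMod N) ^ m • xi N 1 m :=
    fun m => by
      rw [act_xi]
      simp [SL2.coe_diag, xi, -ZMod.inv_coe_unit, DividedPowerAlgebra.dp_smul]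
  have f0 : ∀ m, linSubst (SL2.diag s).1 (X 0 ^ m) = (s : ZMod N) ^ m • X 0 ^ m := fun m => by
    rw [map_pow, linSubst_X]
    simp [SL2.coe_diag, mul_pow, smul_eq_C_mul]
  have f1 : ∀ m, linSubst (SL2.diag s).1 (X 1 ^ m) =
      ((s⁻¹ : (ZMod N)ˣ) : ZMod N) ^ m • X 1 ^ m := fun m => by
    rw [map_pow, linSubst_X]
    simp [SL2.coe_diag, mul_pow, smul_eq_C_mul]
  simp only [ofFunctional, map_sum, map_smul, map_mul, e0, e1, LinearMap.comp_apply,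
    AlgHom.toLinearMap_apply, f0, f1, smul_mul_smul_comm]
  refine Finset.sum_congr rfl fun x _ => ?_
  rw [smul_smul, smul_eq_mul]
  congr 1
  ring

/-- Both `act` and precomposition with `linSubst` reverse products, so the identity need only be
checked on generators. -/
theorem act_ofFunctional [IsLocalRing (ZMod N)] (n : ℕ)
    (g : Matrix.SpecialLinearGroup (Fin 2) (ZMod N))
    (φ : MvPolynomial (Fin 2) (ZMod N) →ₗ[ZMod N] ZMod N) :
    act g (ofFunctional n φ) = ofFunctional n (φ ∘ₗ (linSubst g.1).toLinearMap) := by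
  induction g using SL2.induction_of_isLocalRing generalizing φ with
  | hu t => exact act_upper_ofFunctional n φ t
  | hl t => exact act_lower_ofFunctional n φ t
  | hd s => exact act_diag_ofFunctional n φ s
  | hm g h hg hh =>
    rw [act_mul, hg, hh]
    refine congrArg (ofFunctional n) ?_
    refine LinearMap.ext fun f => ?_
    rw [Matrix.SpecialLinearGroup.coe_mul]
    simp only [LinearMap.comp_apply, AlgHom.toLinearMap_apply, linSubst_mul]

end DivPow

/-! ### Linear independence of divided monomials via an integral lattice in `ℚ[x, y]` -/

/-- The subring of `ℚ[x, y]` spanned over `ℤ` by the products `x ^ m / m! * y ^ n / n!`. -/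
noncomputable def dpLattice : Subring (MvPolynomial (Fin 2) ℚ) where
  carrier := {f | ∀ s, ∃ z : ℤ, coeff s f * ((s 0).factorial * (s 1).factorial) = z}
  mul_mem' := by
    intro f g hf hg s
    have h : ∀ x : (Fin 2 →₀ ℕ) × (Fin 2 →₀ ℕ), x ∈ Finset.HasAntidiagonal.antidiagonal s →
        ∃ z : ℤ, coeff x.1 f * coeff x.2 g * ((s 0).factorial * (s 1).factorial) = z := by
      intro x hx
      rw [Finset.HasAntidiagonal.mem_antidiagonal] at hx
      subst hx
      obtain ⟨a, ha⟩ := hf x.1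
      obtain ⟨b, hb⟩ := hg x.2
      refine ⟨a * b * ((x.1 0 + x.2 0).choose (x.2 0) * (x.1 1 + x.2 1).choose (x.2 1) : ℕ), ?_⟩
      push_cast
      rw [← ha, ← hb, Pi.add_apply, Pi.add_apply,
        ← Nat.add_choose_mul_factorial_mul_factorial (x.1 0) (x.2 0),
        ← Nat.add_choose_mul_factorial_mul_factorial (x.1 1) (x.2 1)]
      push_cast
      ring
    choose! z hz using h
    refine ⟨∑ x ∈ Finset.HasAntidiagonal.antidiagonal s, z x, ?_⟩
    rw [coeff_mul, Finset.sum_mul, Int.cast_sum]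
    exact Finset.sum_congr rfl hz
  one_mem' := by
    intro s
    rw [coeff_one]
    split_ifs with h
    · subst h
      exact ⟨1, by simp⟩
    · exact ⟨0, by simp⟩
  add_mem' := by
    intro f g hf hg s
    obtain ⟨a, ha⟩ := hf s
    obtain ⟨b, hb⟩ := hg s
    exact ⟨a + b, by rw [coeff_add, add_mul, ha, hb, Int.cast_add]⟩
  zero_mem' := fun s => ⟨0, by simp⟩
  neg_mem' := by
    intro f hf s
    obtain ⟨a, ha⟩ := hf s
    exact ⟨-a, by rw [coeff_neg, neg_mul, ha, Int.cast_neg]⟩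

namespace dpLattice

/-- The rational divided power `(v₀ x + v₁ y) ^ n / n!`. -/
noncomputable def ratPow (v : Fin 2 → ℤ) (n : ℕ) : MvPolynomial (Fin 2) ℚ :=
  (n.factorial : ℚ)⁻¹ • ((v 0 : ℚ) • X 0 + (v 1 : ℚ) • X 1) ^ n

theorem ratPow_add (u v : Fin 2 → ℤ) (n : ℕ) :
    ratPow (u + v) n =
      ∑ x ∈ Finset.HasAntidiagonal.antidiagonal n, ratPow u x.1 * ratPow v x.2 := by
  have h : (((u + v) 0 : ℤ) : ℚ) • (X 0 : MvPolynomial (Fin 2) ℚ) + (((u + v) 1 : ℤ) : ℚ) • X 1 =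
      ((u 0 : ℚ) • X 0 + (u 1 : ℚ) • X 1) + ((v 0 : ℚ) • X 0 + (v 1 : ℚ) • X 1) := by
    simp only [Pi.add_apply, Int.cast_add, add_smul]
    abel
  rw [ratPow, h, (Commute.all _ _).add_pow', Finset.smul_sum]
  refine Finset.sum_congr rfl fun x hx => ?_
  rw [← Finset.HasAntidiagonal.mem_antidiagonal.mp hx, ratPow, ratPow, smul_mul_smul_comm,
    Nat.choose_symm_add, ← Nat.cast_smul_eq_nsmul ℚ, smul_smul, ← Nat.add_choose_mul_factorial_mul_factorial]
  have h1 := Nat.cast_ne_zero (R := ℚ) |>.mpr (Nat.factorial_ne_zero x.1)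
  have h2 := Nat.cast_ne_zero (R := ℚ) |>.mpr (Nat.factorial_ne_zero x.2)
  have h3 : ((x.1 + x.2).choose x.2 : ℚ) ≠ 0 :=
    Nat.cast_ne_zero.mpr (Nat.choose_pos (Nat.le_add_left _ _)).ne'
  congr 1
  push_cast
  field_simp

theorem ratPow_smul (k : ℤ) (v : Fin 2 → ℤ) (n : ℕ) : ratPow (k • v) n = k ^ n • ratPow v n := by
  have h : (((k • v) 0 : ℤ) : ℚ) • (X 0 : MvPolynomial (Fin 2) ℚ) + (((k • v) 1 : ℤ) : ℚ) • X 1 =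
      (k : ℚ) • ((v 0 : ℚ) • X 0 + (v 1 : ℚ) • X 1) := by
    simp [smul_smul, smul_add]
  rw [ratPow, h, smul_pow, ratPow, smul_comm, ← Int.cast_pow, Int.cast_smul_eq_zsmul]

theorem ratPow_mul (v : Fin 2 → ℤ) (m n : ℕ) :
    ratPow v m * ratPow v n = (m + n).choose m • ratPow v (m + n) := by
  rw [ratPow, ratPow, ratPow, smul_mul_smul_comm, ← pow_add, Nat.choose_symm_add,
    ← Nat.cast_smul_eq_nsmul ℚ, smul_smul,
    ← Nat.add_choose_mul_factorial_mul_factorial]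
  have h1 := Nat.cast_ne_zero (R := ℚ) |>.mpr (Nat.factorial_ne_zero m)
  have h2 := Nat.cast_ne_zero (R := ℚ) |>.mpr (Nat.factorial_ne_zero n)
  have h3 : ((m + n).choose n : ℚ) ≠ 0 :=
    Nat.cast_ne_zero.mpr (Nat.choose_pos (Nat.le_add_left _ _)).ne'
  congr 1
  push_cast
  field_simp

theorem ratPow_single_mul_single (i j : ℕ) :
    ratPow (Pi.single 0 1) i * ratPow (Pi.single 1 1) j =
      ((i.factorial : ℚ)⁻¹ * (j.factorial : ℚ)⁻¹) • (X 0 ^ i * X 1 ^ j) := by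
  simp [ratPow, smul_smul, mul_comm]

theorem smul_binary_monomial_mem (i j : ℕ) :
    ((i.factorial : ℚ)⁻¹ * (j.factorial : ℚ)⁻¹) • (X 0 ^ i * X 1 ^ j : MvPolynomial (Fin 2) ℚ) ∈
      dpLattice := by
  intro s
  have hs : s = Finsupp.single 0 (s 0) + Finsupp.single 1 (s 1) := by
    ext k; fin_cases k <;> simp
  rw [hs, coeff_smul, coeff_binary_monomial, ← hs]
  split_ifs with h
  · rw [h.1, h.2]
    have h1 := Nat.cast_ne_zero (R := ℚ) |>.mpr (Nat.factorial_ne_zero (s 0))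
    have h2 := Nat.cast_ne_zero (R := ℚ) |>.mpr (Nat.factorial_ne_zero (s 1))
    refine ⟨1, ?_⟩
    push_cast
    rw [smul_eq_mul]
    field_simp
  · exact ⟨0, by simp⟩

theorem ratPow_mem (v : Fin 2 → ℤ) (n : ℕ) : ratPow v n ∈ dpLattice := by
  have hv : v = v 0 • Pi.single 0 1 + v 1 • Pi.single 1 1 := by
    ext k; fin_cases k <;> simp
  rw [hv, ratPow_add]
  refine Subring.sum_mem _ fun x _ => ?_
  rw [ratPow_smul, ratPow_smul, smul_mul_smul_comm, ratPow_single_mul_single]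
  exact Subring.zsmul_mem _ (smul_binary_monomial_mem _ _) _

/-- The integral divided powers `(v₀ x + v₁ y) ^ n / n!` in the lattice modulo `N`. -/
noncomputable def modPow (N : ℕ) (v : Fin 2 → ℤ) (n : ℕ) : dpLattice ⧸ Ideal.span {(N : dpLattice)} :=
  Ideal.Quotient.mk _ ⟨ratPow v n, ratPow_mem v n⟩

variable {N : ℕ}

theorem modPow_zero (v : Fin 2 → ℤ) : modPow N v 0 = 1 := by
  rw [modPow, ← map_one (Ideal.Quotient.mk _)]
  congr 1
  ext1
  simp [ratPow]

theorem modPow_add (u v : Fin 2 → ℤ) (n : ℕ) : modPow N (u + v) n =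
    ∑ x ∈ Finset.HasAntidiagonal.antidiagonal n, modPow N u x.1 * modPow N v x.2 := by
  simp only [modPow, ← map_mul, ← map_sum]
  congr 1
  ext1
  simp [ratPow_add]

theorem modPow_smul (k : ℤ) (v : Fin 2 → ℤ) (n : ℕ) :
    modPow N (k • v) n = k ^ n • modPow N v n := by
  rw [modPow, modPow, ← map_zsmul]
  congr 1
  ext1
  exact ratPow_smul k v n

theorem modPow_mul (v : Fin 2 → ℤ) (m n : ℕ) :
    modPow N v m * modPow N v n = (m + n).choose m • modPow N v (m + n) := by
  rw [modPow, modPow, modPow, ← map_nsmul, ← map_mul]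
  congr 1
  ext1
  simp [ratPow_mul]

theorem nsmul_quotient (x : dpLattice ⧸ Ideal.span {(N : dpLattice)}) : N • x = 0 := by
  have : ((N : ℕ) : dpLattice ⧸ Ideal.span {(N : dpLattice)}) = 0 := by
    rw [← map_natCast (Ideal.Quotient.mk _), Ideal.Quotient.eq_zero_iff_mem]
    exact Ideal.mem_span_singleton_self _
  rw [nsmul_eq_mul, this, zero_mul]

/-- In the addition formula every term with a positive power of `N • w` is divisible by `N`. Hence
`modPow` depends only on the vector modulo `N`, which is what makes `ofDivPow` well defined. -/
theorem modPow_add_smul (v w : Fin 2 → ℤ) (n : ℕ) :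
    modPow N (v + (N : ℤ) • w) n = modPow N v n := by
  rw [modPow_add, Finset.sum_eq_single (n, 0)]
  · rw [modPow_zero, mul_one]
  · rintro ⟨a, b⟩ hab hne
    have hb : b ≠ 0 := by
      rintro rfl
      rw [Finset.HasAntidiagonal.mem_antidiagonal, add_zero] at hab
      exact hne (by rw [← hab])
    obtain ⟨c, rfl⟩ := Nat.exists_eq_succ_of_ne_zero hb
    rw [modPow_smul, pow_succ', mul_smul, natCast_zsmul, nsmul_quotient, mul_zero]
  · intro h
    exact absurd (Finset.HasAntidiagonal.mem_antidiagonal.mpr (add_zero n)) h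

theorem modPow_congr {u v : Fin 2 → ℤ} (h : ∀ i, (u i : ZMod N) = v i) (n : ℕ) :
    modPow N u n = modPow N v n := by
  have h1 : ∀ i, (N : ℤ) ∣ u i - v i := fun i => by
    rw [← ZMod.intCast_zmod_eq_zero_iff_dvd, Int.cast_sub, h, sub_self]
  choose w hw using h1
  have : u = v + (N : ℤ) • w := by
    ext i
    simp [← hw]
  rw [this, modPow_add_smul]

noncomputable instance : Module (ZMod N) (dpLattice ⧸ Ideal.span {(N : dpLattice)}) :=
  AddCommGroup.zmodModule nsmul_quotient

noncomputable instance : Algebra (ZMod N) (dpLattice ⧸ Ideal.span {(N : dpLattice)}) :=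
  Algebra.ofModule
    (fun r x y => by
      obtain ⟨k, rfl⟩ := ZMod.intCast_surjective r
      rw [Int.cast_smul_eq_zsmul, Int.cast_smul_eq_zsmul, smul_mul_assoc])
    (fun r x y => by
      obtain ⟨k, rfl⟩ := ZMod.intCast_surjective r
      rw [Int.cast_smul_eq_zsmul, Int.cast_smul_eq_zsmul, mul_smul_comm])

/-- The comparison map from the divided power algebra to the lattice modulo `N`. -/
noncomputable def ofDivPow (N : ℕ) :
    DivPow N →ₐ[ZMod N] dpLattice ⧸ Ideal.span {(N : dpLattice)} :=
  DividedPowerAlgebra.lift' (f := fun x => modPow N (fun i => (x.2 i).cast) x.1)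
    (fun _ => modPow_zero _)
    (fun n r m => by
      obtain ⟨k, rfl⟩ := ZMod.intCast_surjective r
      dsimp only
      rw [← Int.cast_pow, Int.cast_smul_eq_zsmul (ZMod N) (k ^ n) (modPow _ _ _), ← modPow_smul]
      exact modPow_congr (fun i => by simp) n)
    (fun n p m => modPow_mul _ _ _)
    (fun n u v => by
      dsimp only
      rw [← modPow_add]
      exact modPow_congr (fun i => by simp) n)

theorem ofDivPow_xi (i : Fin 2) (m : ℕ) :
    ofDivPow N (DivPow.xi N i m) = modPow N (Pi.single i 1) m := by
  rw [ofDivPow, DivPow.xi, DividedPowerAlgebra.lift'_apply_dp]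
  refine modPow_congr (fun j => ?_) m
  by_cases h : j = i
  · subst h; simp
  · simp [h]

end dpLattice

namespace DivPow

/-- The divided monomials of degree `n` are linearly independent. -/
theorem eq_zero_of_ofFunctional_eq_zero {N n : ℕ}
    {φ : MvPolynomial (Fin 2) (ZMod N) →ₗ[ZMod N] ZMod N} (h : ofFunctional n φ = 0) {i j : ℕ}
    (hij : i + j = n) : φ (X 0 ^ i * X 1 ^ j) = 0 := by
  choose c hc using fun x : ℕ × ℕ => ZMod.intCast_surjective (φ (X 0 ^ x.1 * X 1 ^ x.2))
  have h1 := congrArg (dpLattice.ofDivPow N) h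
  simp only [ofFunctional, map_sum, map_smul, map_mul, dpLattice.ofDivPow_xi, map_zero, ← hc,
    Int.cast_smul_eq_zsmul, dpLattice.modPow] at h1
  simp only [← map_mul, ← map_zsmul, ← map_sum] at h1
  rw [Ideal.Quotient.eq_zero_iff_mem, Ideal.mem_span_singleton] at h1
  obtain ⟨⟨f, hf⟩, h2⟩ := h1
  have h3 := congrArg (fun g : dpLattice => coeff (Finsupp.single 0 i + Finsupp.single 1 j)
    (g : MvPolynomial (Fin 2) ℚ)) h2
  obtain ⟨z, hz⟩ := hf (Finsupp.single 0 i + Finsupp.single 1 j)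
  simp only [Subring.coe_mul, Subring.coe_natCast, AddSubmonoidClass.coe_finsetSum,
    AddSubgroupClass.coe_zsmul, dpLattice.ratPow_single_mul_single, coeff_sum, coeff_smul,
    coeff_binary_monomial] at h3
  rw [Finset.sum_eq_single (i, j)] at h3
  · rw [← map_natCast (C : ℚ →+* MvPolynomial (Fin 2) ℚ), coeff_C_mul] at h3
    simp at h3 hz
    have h4 := Nat.cast_ne_zero (R := ℚ) |>.mpr (Nat.factorial_ne_zero i)
    have h5 := Nat.cast_ne_zero (R := ℚ) |>.mpr (Nat.factorial_ne_zero j)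
    -- The coefficient of `x ^ i y ^ j` gives `c / (i! j!) = N * coeff f`, and lattice membership
    -- makes `i! j! * coeff f` the integer `z`.
    have h6 : (c (i, j) : ℚ) = N * z := by
      rw [← hz, ← mul_assoc, ← h3]
      field_simp
    have h7 : c (i, j) = N * z := by exact_mod_cast h6
    rw [← hc (i, j), h7]
    simp
  · rintro ⟨k, l⟩ _ hne
    rw [if_neg]
    · simp
    · rintro ⟨rfl, rfl⟩
      exact hne rfl
  · intro hn
    exact absurd (Finset.HasAntidiagonal.mem_antidiagonal.mpr hij) hn

end DivPow

/-! ### Reduction modulo `p`, primitivity and conclusion -/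

theorem isTruncation_castHom {p e N : ℕ} (h : p ∣ N) (hN : N ∣ p ^ (e + 1)) :
    IsTruncation p e (ZMod.castHom h (ZMod p)) where
  surjective := ZMod.castHom_surjective h
  ker r := by
    constructor
    · intro hr
      obtain ⟨z, rfl⟩ := ZMod.intCast_surjective r
      rw [map_intCast, ZMod.intCast_zmod_eq_zero_iff_dvd] at hr
      obtain ⟨y, rfl⟩ := hr
      exact ⟨y, by simp⟩
    · rintro ⟨s, rfl⟩
      rw [map_mul, map_natCast, CharP.cast_eq_zero, zero_mul]
  pow_eq_zero := by
    rw [← Nat.cast_pow, ZMod.natCast_eq_zero_iff]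
    exact hN

/-- A functional killing `L ^ q` and `Q ^ q` reduces to one over `𝔽_p`. -/
theorem IsDicksonFunctional.exists_reduction {R : Type*} [CommRing R] {p q : ℕ} {π : R →+* ZMod p}
    (hπ : Function.Surjective π) {φ : MvPolynomial (Fin 2) R →ₗ[R] R}
    (hφ : IsDicksonFunctional p q φ) :
    ∃ ψ : MvPolynomial (Fin 2) (ZMod p) →ₗ[ZMod p] ZMod p,
      IsDicksonFunctional p q ψ ∧ ∀ f, ψ (map π f) = π (φ f) := by
  have h1 := fun f => map_formFunctional π (n := 2 * (q - 1) + (p + 1) * (q * (p - 1)))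
    (fun m => φ (X 0 ^ (m : ℕ) * X 1 ^ (2 * (q - 1) + (p + 1) * (q * (p - 1)) - m))) f
  rw [← eq_formFunctional hφ.degree] at h1
  refine ⟨_, ⟨fun f => ?_, fun f => ?_, fun i j hij => formFunctional_degree _ i j hij⟩,
    fun f => (h1 f).symm⟩
  -- Every multiple of `L ^ q` over `𝔽_p` lifts to a multiple over `R`, which `φ` kills.
  · obtain ⟨f, rfl⟩ := map_surjective π hπ f
    rw [← map_dicksonL π, ← map_pow, ← map_mul, ← h1, hφ.left, map_zero]
  · obtain ⟨f, rfl⟩ := map_surjective π hπ f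
    rw [← map_dicksonQ π, ← map_pow, ← map_mul, ← h1, hφ.right, map_zero]

namespace DivPow

theorem reduction_ofFunctional {M N : ℕ} (h : M ∣ N) (n : ℕ)
    {φ : MvPolynomial (Fin 2) (ZMod N) →ₗ[ZMod N] ZMod N}
    {ψ : MvPolynomial (Fin 2) (ZMod M) →ₗ[ZMod M] ZMod M}
    (hψ : ∀ f, ψ (map (ZMod.castHom h (ZMod M)) f) = ZMod.castHom h (ZMod M) (φ f)) :
    reduction h (ofFunctional n φ) = ofFunctional n ψ := by
  rw [ofFunctional, ofFunctional, map_sum]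
  refine Finset.sum_congr rfl fun x _ => ?_
  have hx := hψ (X 0 ^ x.1 * X 1 ^ x.2)
  rw [map_mul, map_pow, map_pow, map_X, map_X] at hx
  rw [Algebra.smul_def, map_mul (reduction h), map_mul (reduction h), reduction_xi, reduction_xi,
    reduction_algebraMap, ← hx, ← Algebra.smul_def]

theorem ofFunctional_eq_u {p e : ℕ} [Fact p.Prime]
    {φ : MvPolynomial (Fin 2) (ZMod p) →ₗ[ZMod p] ZMod p} (hφ : IsDicksonFunctional p (p ^ e) φ)
    (h1 : φ (X 0 ^ (p ^ e - 1 + p ^ e * (p - 1)) *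
      X 1 ^ (p ^ e - 1 + p * (p ^ e * (p - 1)))) = 1) :
    ofFunctional (2 * (p ^ e - 1) + (p + 1) * (p ^ e * (p - 1))) φ = u p (e + 1) := by
  have hp := (Fact.out : p.Prime)
  obtain ⟨hv, h0⟩ := dicksonFunctional_values hφ
  rw [h1] at hv
  have hd : 0 < p ^ e * (p - 1) := Nat.mul_pos (Nat.pow_pos hp.pos) (Nat.sub_pos_of_lt hp.one_lt)
  symm
  rw [u, ofFunctional, Nat.add_sub_cancel]
  refine Finset.sum_of_injOn (fun j => (p ^ e - 1 + j * p ^ e * (p - 1),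
    p ^ e - 1 + (p - j + 1) * p ^ e * (p - 1))) ?_ ?_ ?_ ?_
  · intro i _ j _ hij
    have h2 := (Prod.ext_iff.mp hij).1
    simp only [add_right_inj, mul_assoc] at h2
    exact Nat.eq_of_mul_eq_mul_right hd h2
  · intro j hj
    simp only [Finset.coe_Icc, Set.mem_Icc] at hj
    obtain ⟨k, rfl⟩ := Nat.exists_eq_add_of_le hj.2
    rw [Finset.mem_coe, Finset.HasAntidiagonal.mem_antidiagonal]
    simp only [Nat.add_sub_cancel_left]
    ring
  · rintro ⟨M, M'⟩ hM hne
    rw [Finset.HasAntidiagonal.mem_antidiagonal] at hM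
    rw [h0 M M' hM, zero_smul]
    rintro j hj rfl
    refine hne ⟨j + 1, by simp; omega, ?_⟩
    obtain ⟨k, rfl⟩ := Nat.exists_eq_add_of_lt hj
    dsimp only at hM ⊢
    rw [show j + k + 1 - (j + 1) + 1 = k + 1 by omega]
    have e4 : (j + k + 1 + 1) * ((j + k + 1) ^ e * (j + k + 1 - 1)) =
      (j + 1) * ((j + k + 1) ^ e * (j + k + 1 - 1)) +
        (k + 1) * ((j + k + 1) ^ e * (j + k + 1 - 1)) := by ring
    simp only [mul_assoc, Prod.mk.injEq, true_and]
    omega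
  · intro j hj
    rw [Finset.mem_Icc] at hj
    obtain ⟨i, rfl⟩ := Nat.exists_eq_add_of_le' hj.1
    have h2 := hv i (by omega)
    -- The index in `u` starts at `1` and that of `dicksonFunctional_values` at `0`, so `j = i + 1`.
    simp only [mul_assoc, show p - (i + 1) + 1 = p - i by omega]
    rw [h2, one_smul]

/-- If `p ^ e` killed `w`, linear independence would make `p ^ e` kill the coefficient `1`, although
`p ^ e ≠ 0` in `ℤ/p ^ (e + 1)`. -/
theorem isPrimitive_of_coe_eq_ofFunctional {p e n : ℕ} [Fact p.Prime]
    {w : invariants (p ^ (e + 1))}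
    {φ : MvPolynomial (Fin 2) (ZMod (p ^ (e + 1))) →ₗ[ZMod (p ^ (e + 1))] ZMod (p ^ (e + 1))}
    (hw : (w : DivPow (p ^ (e + 1))) = ofFunctional n φ) {i j : ℕ} (hij : i + j = n)
    (h1 : φ (X 0 ^ i * X 1 ^ j) = 1) : IsPrimitive w := by
  have hp := (Fact.out : p.Prime)
  refine addOrderOf_eq_prime_pow (fun h => ?_) ?_
  · have h2 := congrArg (Subtype.val) h
    change p ^ e • (w : DivPow (p ^ (e + 1))) = 0 at h2
    have h3 : ofFunctional n (((p ^ e : ℕ) : ZMod (p ^ (e + 1))) • φ) = 0 := by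
      rw [← h2, hw, ← Nat.cast_smul_eq_nsmul (ZMod (p ^ (e + 1))), ofFunctional, ofFunctional,
        Finset.smul_sum]
      refine Finset.sum_congr rfl fun x _ => ?_
      rw [LinearMap.smul_apply, smul_assoc]
    have h4 := eq_zero_of_ofFunctional_eq_zero h3 hij
    rw [LinearMap.smul_apply, h1, smul_eq_mul, mul_one, ZMod.natCast_eq_zero_iff] at h4
    exact absurd (Nat.le_of_dvd (Nat.pow_pos hp.pos) h4)
      (not_le.mpr (Nat.pow_lt_pow_right hp.one_lt (Nat.lt_succ_self e)))
  · apply Subtype.ext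
    change p ^ (e + 1) • (w : DivPow (p ^ (e + 1))) = 0
    rw [← Nat.cast_smul_eq_nsmul (ZMod (p ^ (e + 1))), CharP.cast_eq_zero, zero_smul]

theorem ofFunctional_mem_invariants {N n : ℕ} [IsLocalRing (ZMod N)]
    {φ : MvPolynomial (Fin 2) (ZMod N) →ₗ[ZMod N] ZMod N}
    (h : ∀ g : Matrix.SpecialLinearGroup (Fin 2) (ZMod N),
      φ ∘ₗ (linSubst (g : Matrix (Fin 2) (Fin 2) (ZMod N))).toLinearMap = φ) :
    ofFunctional n φ ∈ invariants N := by
  intro g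
  rw [act_ofFunctional, h g]

end DivPow

theorem mainTheorem7 (p δ : ℕ) (hp : p.Prime) (hp3 : 3 < p) (hδ : 1 ≤ δ) :
    DivPow.u p δ ∈ DivPow.invariants p ∧
      ∃ w : DivPow.invariants (p ^ δ), DivPow.IsPrimitive w ∧
        DivPow.reduction (dvd_pow_self p (Nat.one_le_iff_ne_zero.mp hδ))
          (w : DivPow (p ^ δ)) = DivPow.u p δ := by
  obtain ⟨e, rfl⟩ := Nat.exists_eq_add_of_le' hδ
  have : Fact p.Prime := ⟨hp⟩
  constructor
  -- Invariance of `u_δ` is the case `R = 𝔽_p` with the same exponent `e`, where `p ^ (e + 1) = 0`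
  -- holds trivially.
  · have ht := isTruncation_castHom (e := e) (dvd_refl p) (dvd_pow_self p e.succ_ne_zero)
    obtain ⟨φ, hφ, h1, hinv⟩ := ht.exists_invariant_dicksonFunctional hp3
    rw [← DivPow.ofFunctional_eq_u hφ h1]
    exact DivPow.ofFunctional_mem_invariants hinv
  · have ht := isTruncation_castHom (dvd_pow_self p e.succ_ne_zero) (dvd_refl (p ^ (e + 1)))
    have : NeZero (p ^ (e + 1)) := ⟨pow_ne_zero _ hp.ne_zero⟩
    have := ht.isLocalRing
    obtain ⟨φ, hφ, h1, hinv⟩ := ht.exists_invariant_dicksonFunctional hp3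
    refine ⟨⟨DivPow.ofFunctional (2 * (p ^ e - 1) + (p + 1) * (p ^ e * (p - 1))) φ, DivPow.ofFunctional_mem_invariants hinv⟩,
      DivPow.isPrimitive_of_coe_eq_ofFunctional rfl (by ring) h1, ?_⟩
    -- The reduced functional is again a Dickson functional with value `1` at the normalizing
    -- monomial, so it gives `u_δ`.
    obtain ⟨ψ, hψ, hred⟩ := hφ.exists_reduction ht.surjective
    rw [← DivPow.ofFunctional_eq_u hψ]
    · exact DivPow.reduction_ofFunctional _ _ hred
    · have h2 := hred (X 0 ^ (p ^ e - 1 + p ^ e * (p - 1)) *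
        X 1 ^ (p ^ e - 1 + p * (p ^ e * (p - 1))))
      rw [h1, map_one] at h2
      simpa using h2
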